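/- Let $\mathbf k$ be a perfect field, let $L=\mathbf k(\theta)$ and $L'=\mathbf k(\theta')$ be two quadratic extensions of $\mathbf k$ in a common algebraic closure, and let $K=LL'$. If $L=L'$, let $g$ be the generator of $\mathrm{Gal}(K/\mathbf k)$. If $L\neq L'$, let $h,h'$ be the generators of $\mathrm{Gal}(L/\mathbf k)$ and $\mathrm{Gal}(L'/\mathbf k)$, viewed in $\mathrm{Gal}(K/\mathbf k)=\mathrm{Gal}(L/\mathbf k)\times\mathrm{Gal}(L'/\mathbf k)$, and let $g=hh'$. Write $a^\sigma$ for the action of $\sigma\in\mathrm{Gal}(K/\mathbf k)$ on $a\in K$. Let $\pi_{L,L'}\colon\mathbb P^2\dashrightarrow\mathbb P^1$ be the fibration given by the pencil of conics through the points $[\theta':1:0],[\theta'^g:1:0],[\theta:0:1],[\theta^g:0:1]$, namely $$[x:y:z]\mapsto[(x-\theta'y)(x-\theta'^g y)+(x-\theta z)(x-\theta^g z)-x^2: yz].$$ Let $\mathrm{Bir}_{\mathbf k}(\mathbb P^2,\pi_{L,L'})$ be the group of all $f\in\mathrm{Bir}_{\mathbf k}(\mathbb P^2)$ for which there is $\alpha\in\mathrm{Aut}_{\mathbf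 k}(\mathbb P^1)$ with $\pi_{L,L'}\circ f=\alpha\circ\pi_{L,L'}$, and let $\mathrm{Aut}_{\mathbf k}^{\pi_{L,L'}}(\mathbb P^1)$ be the image of the homomorphism $\mathrm{Bir}_{\mathbf k}(\mathbb P^2,\pi_{L,L'})\to\mathrm{Aut}_{\mathbf k}(\mathbb P^1)$, $f\mapsto\alpha$. In the affine charts $(x,y)\mapsto[x:y:1]$ of $\mathbb P^2$ and $(x,y)\mapsto([x:1],[y:1])$ of $\mathbb P^1\times\mathbb P^1$, let $\varepsilon=\gamma\circ\beta\circ\alpha\colon\mathbb P^2\dashrightarrow\mathbb P^1\times\mathbb P^1$ be the birational map over $K$ with $$\alpha(x,y)=(x-\theta'y,\;x-\theta'^g y),\qquad \beta(x,y)=\Bigl(\frac{x-\theta}{-x+\theta^g},\frac{y-\theta^g}{-y+\theta}\Bigr),\qquad \gamma(x,y)=(xy,y).$$ Let $H_{L,L'}\subset\mathrm{Bir}_K(\mathbb A^2)$ be the group generated by the maps $$(x,y)\dashrightarrow\Bigl(\frac1{\mu x},\frac1{\lambda y}\Bigr),\qquad \mu=\lambda\lambda^g,$$ where $\lambda$ runs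 through $K^*$ if $L=L'$, and through the elements of $K^*$ with $\lambda\lambda^h=1$ if $L\neq L'$. Then these maps are involutions, the group $\varepsilon^{-1}H_{L,L'}\,\varepsilon$ is contained in $\mathrm{Bir}_{\mathbf k}(\mathbb P^2,\pi_{L,L'})$ (viewed in $\mathrm{Bir}_K(\mathbb P^2)$), and it surjects onto $\mathrm{Aut}_{\mathbf k}^{\pi_{L,L'}}(\mathbb P^1)$. -/

import Mathlib

open scoped MatrixGroups IntermediateField

noncomputable section

namespace Jonq22

universe u v

/-! ### Function fields and birational maps of surfaces with a chart `𝔸²` -/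

/-- The field `F(x, y)` of rational functions on `𝔸²` over `F`.  It is the function field of `ℙ²`
through the chart `(x, y) ↦ [x : y : 1]`, and the function field of `ℙ¹ × ℙ¹` through the chart
`(x, y) ↦ ([x : 1], [y : 1])`. -/
abbrev FunField (F : Type u) [Field F] : Type u := FractionRing (MvPolynomial (Fin 2) F)

/-- The coordinate functions: `coord F 0 = x` and `coord F 1 = y`. -/
def coord (F : Type u) [Field F] (i : Fin 2) : FunField F :=
  algebraMap (MvPolynomial (Fin 2) F) (FunField F) (MvPolynomial.X i)

/-- The group of birational self-maps over `F` of `𝔸²` (equivalently of `ℙ²`, or of `ℙ¹ × ℙ¹`,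
through the charts above), that is, the plane Cremona group over `F`.

A birational map `f` is recorded by its comorphism `f^* : φ ↦ φ ∘ f`, an `F`-automorphism of
the function field `F(x, y)`; in coordinates, `f = (f^* x, f^* y)`.
As `(f ∘ g)^* = g^* ∘ f^*`, the group law "composition of birational maps"
is the opposite of the composition of comorphisms. -/
abbrev Bir (F : Type u) [Field F] : Type u := (FunField F ≃ₐ[F] FunField F)ᵐᵒᵖ

/-- The comorphism `φ ↦ φ ∘ f` of a birational map `f`. -/
def Bir.pullback {F : Type u} [Field F] (f : Bir F) : FunField F ≃ₐ[F] FunField F := f.unop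

section Coordinates

variable {F : Type u} [Field F]

theorem Bir.pullback_mul (f g : Bir F) (z : FunField F) :
    (f * g).pullback z = g.pullback (f.pullback z) := rfl

theorem Bir.pullback_one (z : FunField F) : (1 : Bir F).pullback z = z := rfl

theorem adjoin_coord : IntermediateField.adjoin F (Set.range (coord F)) = ⊤ := by
  rw [eq_top_iff]
  intro z _
  obtain ⟨p, q, -, rfl⟩ := IsFractionRing.div_surjective (MvPolynomial (Fin 2) F) z
  have key : ∀ p : MvPolynomial (Fin 2) F, algebraMap _ (FunField F) p ∈
      IntermediateField.adjoin F (Set.range (coord F)) := by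
    intro p
    induction p using MvPolynomial.induction_on with
    | C a =>
      have : algebraMap (MvPolynomial (Fin 2) F) (FunField F) (MvPolynomial.C a)
          = algebraMap F (FunField F) a := by
        rw [IsScalarTower.algebraMap_apply F (MvPolynomial (Fin 2) F) (FunField F)]; rfl
      rw [this]
      exact IntermediateField.algebraMap_mem _ a
    | add p q hp hq => rw [map_add]; exact add_mem hp hq
    | mul_X p i hp =>
      rw [map_mul]
      exact mul_mem hp (IntermediateField.subset_adjoin _ _ ⟨i, rfl⟩)
  exact div_mem (key p) (key q)

/-- Homomorphisms out of the function field are determined by the images of `x` and `y`. -/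
theorem algHom_ext_coord {E : Type v} [Field E] [Algebra F E] {f g : FunField F →ₐ[F] E}
    (h : ∀ i, f (coord F i) = g (coord F i)) : f = g := by
  apply IsLocalization.algHom_ext (nonZeroDivisors (MvPolynomial (Fin 2) F))
  apply MvPolynomial.algHom_ext
  intro i
  exact h i

theorem algebraicIndependent_coord : AlgebraicIndependent F (coord F) := by
  have h := (MvPolynomial.algebraicIndependent_X (Fin 2) F).map'
    (f := IsScalarTower.toAlgHom F (MvPolynomial (Fin 2) F) (FunField F))
    (IsFractionRing.injective (MvPolynomial (Fin 2) F) (FunField F))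
  exact h

/-- Two functions over whose field everything is algebraic are algebraically independent. -/
theorem algebraicIndependent_of_algebraic (f : Fin 2 → FunField F)
    (h : Algebra.IsAlgebraic (Algebra.adjoin F (Set.range f)) (FunField F)) :
    AlgebraicIndependent F f := by
  refine (Algebra.IsAlgebraic.isTranscendenceBasis_of_lift_le_trdeg_of_finite F f ?_).1
  exact algebraicIndependent_coord.lift_cardinalMk_le_trdeg

theorem isAlgebraic_adjoin_of_mem {s : Set (FunField F)} {z : FunField F}
    (hz : z ∈ IntermediateField.adjoin F s) : IsAlgebraic (Algebra.adjoin F s) z := by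
  rw [IntermediateField.mem_adjoin_iff_div] at hz
  obtain ⟨a, ha, b, hb, rfl⟩ := hz
  exact (isAlgebraic_algebraMap (⟨a, ha⟩ : Algebra.adjoin F s)).mul
    (isAlgebraic_algebraMap (⟨b, hb⟩ : Algebra.adjoin F s)).inv |> fun h => by
      rw [div_eq_mul_inv]; exact h

theorem algebraicIndependent_of_adjoin {f : Fin 2 → FunField F}
    (h : IntermediateField.adjoin F (Set.range f) = ⊤) : AlgebraicIndependent F f :=
  algebraicIndependent_of_algebraic f
    ⟨fun _ => isAlgebraic_adjoin_of_mem (h ▸ IntermediateField.mem_top)⟩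

/-- Substitution of two functions generating the function field. -/
def substHom {f : Fin 2 → FunField F}
    (h : IntermediateField.adjoin F (Set.range f) = ⊤) : FunField F →ₐ[F] FunField F :=
  IsFractionRing.liftAlgHom (A := MvPolynomial (Fin 2) F) (g := MvPolynomial.aeval f)
    (algebraicIndependent_of_adjoin h)

theorem substHom_coord {f : Fin 2 → FunField F}
    (h : IntermediateField.adjoin F (Set.range f) = ⊤) (i : Fin 2) :
    substHom h (coord F i) = f i := by
  have := IsFractionRing.lift_algebraMap (K := FunField F)
    (g := (MvPolynomial.aeval f : MvPolynomial (Fin 2) F →ₐ[F] FunField F).toRingHom)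
    (algebraicIndependent_of_adjoin h) (MvPolynomial.X i)
  refine this.trans ?_
  simp

theorem substHom_bijective {f : Fin 2 → FunField F}
    (h : IntermediateField.adjoin F (Set.range f) = ⊤) : Function.Bijective (substHom h) := by
  refine ⟨(substHom h).injective, fun z => ?_⟩
  have : IntermediateField.adjoin F (Set.range f) ≤ (substHom h).fieldRange := by
    rw [IntermediateField.adjoin_le_iff]
    rintro _ ⟨i, rfl⟩
    exact ⟨coord F i, substHom_coord h i⟩
  rw [h] at this
  exact this (IntermediateField.mem_top (x := z))

/-- The birational map `(x, y) ↦ (f₀(x, y), f₁(x, y))` given by two rational functions `f₀, f₁`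
that generate the function field. -/
def Bir.ofCoords (f : Fin 2 → FunField F)
    (h : IntermediateField.adjoin F (Set.range f) = ⊤) : Bir F :=
  MulOpposite.op (AlgEquiv.ofBijective (substHom h) (substHom_bijective h))

theorem Bir.pullback_ofCoords (f : Fin 2 → FunField F)
    (h : IntermediateField.adjoin F (Set.range f) = ⊤) (i : Fin 2) :
    (Bir.ofCoords f h).pullback (coord F i) = f i :=
  substHom_coord h i

/-- A birational map is determined by its two coordinates. -/
theorem Bir.ext_coord {f g : Bir F}
    (h : ∀ i, f.pullback (coord F i) = g.pullback (coord F i)) : f = g := by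
  apply MulOpposite.unop_injective
  have : (f.unop : FunField F →ₐ[F] FunField F) = g.unop := algHom_ext_coord h
  ext z
  exact DFunLike.congr_fun this z

end Coordinates

/-! ### Extension of scalars -/

section BaseChange

variable (k : Type u) [Field k] (K : Type v) [Field K] [Algebra k K]

/-- The inclusion `k(x, y) → K(x, y)`. -/
def scalarExt : FunField k →ₐ[k] FunField K :=
  IsFractionRing.liftAlgHom (A := MvPolynomial (Fin 2) k)
    (g := (IsScalarTower.toAlgHom k (MvPolynomial (Fin 2) K) (FunField K)).comp
      (MvPolynomial.mapAlgHom (Algebra.ofId k K)))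
    ((IsFractionRing.injective (MvPolynomial (Fin 2) K) (FunField K)).comp
      (MvPolynomial.map_injective _ (algebraMap k K).injective))

theorem scalarExt_coord (i : Fin 2) : scalarExt k K (coord k i) = coord K i := by
  have := IsFractionRing.lift_algebraMap (K := FunField k)
    (g := ((IsScalarTower.toAlgHom k (MvPolynomial (Fin 2) K) (FunField K)).comp
      (MvPolynomial.mapAlgHom (Algebra.ofId k K))).toRingHom)
    ((IsFractionRing.injective (MvPolynomial (Fin 2) K) (FunField K)).comp
      (MvPolynomial.map_injective _ (algebraMap k K).injective)) (MvPolynomial.X i)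
  refine this.trans ?_
  simp [coord]

variable {k}

theorem adjoin_scalarExt (f : Bir k) :
    IntermediateField.adjoin K
      (Set.range fun i => scalarExt k K (f.pullback (coord k i))) = ⊤ := by
  set M := IntermediateField.adjoin K
      (Set.range fun i => scalarExt k K (f.pullback (coord k i))) with hM
  have h1 : (⊤ : IntermediateField k (FunField k)) ≤
      (M.restrictScalars k).comap ((scalarExt k K).comp (f.pullback : FunField k →ₐ[k] FunField k)) := by
    rw [← adjoin_coord, IntermediateField.adjoin_le_iff]
    rintro _ ⟨i, rfl⟩
    exact IntermediateField.subset_adjoin _ _ ⟨i, rfl⟩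
  rw [eq_top_iff, ← adjoin_coord, IntermediateField.adjoin_le_iff]
  rintro _ ⟨i, rfl⟩
  have h2 := h1 (IntermediateField.mem_top (x := f.pullback.symm (coord k i)))
  have h3 : scalarExt k K (f.pullback (f.pullback.symm (coord k i))) ∈ M := h2
  rwa [AlgEquiv.apply_symm_apply, scalarExt_coord] at h3

/-- The birational map over `K` given by the same formulas as a birational map over `k`. -/
def Bir.extend (f : Bir k) : Bir K :=
  Bir.ofCoords (fun i => scalarExt k K (f.pullback (coord k i))) (adjoin_scalarExt K f)

theorem Bir.pullback_extend (f : Bir k) (z : FunField k) :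
    (Bir.extend K f).pullback (scalarExt k K z) = scalarExt k K (f.pullback z) := by
  have : (((Bir.extend K f).pullback : FunField K →ₐ[K] FunField K).restrictScalars k).comp
      (scalarExt k K) = (scalarExt k K).comp (f.pullback : FunField k →ₐ[k] FunField k) := by
    apply algHom_ext_coord
    intro i
    simp only [AlgHom.comp_apply, scalarExt_coord]
    exact Bir.pullback_ofCoords _ (adjoin_scalarExt K f) i
  exact DFunLike.congr_fun this z

variable (k)

/-- Extension of scalars: the inclusion of `Bir_k(ℙ²)` into `Bir_K(ℙ²)`. -/
def baseChange : Bir k →* Bir K where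
  toFun f := Bir.extend K f
  map_one' := by
    apply Bir.ext_coord
    intro i
    rw [← scalarExt_coord k K i, Bir.pullback_extend, Bir.pullback_one, Bir.pullback_one]
  map_mul' f g := by
    apply Bir.ext_coord
    intro i
    rw [← scalarExt_coord k K i, Bir.pullback_extend, Bir.pullback_mul, Bir.pullback_mul,
      Bir.pullback_extend, Bir.pullback_extend]

theorem baseChange_injective : Function.Injective (baseChange k K) := by
  intro f g h
  apply Bir.ext_coord
  intro i
  apply (scalarExt k K).injective
  change scalarExt k K _ = scalarExt k K _
  rw [← Bir.pullback_extend K f, ← Bir.pullback_extend K g]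
  exact congrArg (fun e : Bir K => e.pullback (scalarExt k K (coord k i))) h

end BaseChange

/-! ### Rational fibrations and Jonquières groups -/

section Fibrations

variable {k : Type u} [Field k]

/-- A rational fibration on `ℙ²` over `k`: a dominant rational map `π : ℙ² ⇢ ℙ¹`, recorded by the
rational function `π ∈ k(x, y)` (the pull-back of the affine coordinate `t = [t : 1]` of `ℙ¹`);
dominance means that this function is transcendental over `k`. -/
structure RationalFibration (k : Type u) [Field k] where
  /-- The rational function. -/
  fn : FunField k
  /-- The map to `ℙ¹` is dominant. -/
  dominant : Transcendental k fn

/-- The homography `z ↦ (a z + b) / (c z + d)` given by the matrix `M = (a, b; c, d)`, applied to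
an element of an extension field. -/
def homography {E : Type v} [Field E] [Algebra k E] (M : GL (Fin 2) k) (z : E) : E :=
  (algebraMap k E (M 0 0) * z + algebraMap k E (M 0 1)) /
    (algebraMap k E (M 1 0) * z + algebraMap k E (M 1 1))

theorem homography_one {E : Type v} [Field E] [Algebra k E] (z : E) :
    homography (1 : GL (Fin 2) k) z = z := by
  simp [homography]

theorem linear_ne_zero {E : Type v} [Field E] [Algebra k E] {z : E} (hz : Transcendental k z)
    {a b : k} (h : a ≠ 0 ∨ b ≠ 0) : algebraMap k E a * z + algebraMap k E b ≠ 0 := by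
  intro h0
  have hp : (Polynomial.C a * Polynomial.X + Polynomial.C b : Polynomial k) = 0 := by
    by_contra hne
    exact hz ⟨_, hne, by simpa using h0⟩
  have ha := congrArg (fun p => Polynomial.coeff p 1) hp
  have hb := congrArg (fun p => Polynomial.coeff p 0) hp
  simp [Polynomial.coeff_C] at ha hb
  tauto

theorem row_ne_zero (M : GL (Fin 2) k) : M 1 0 ≠ 0 ∨ M 1 1 ≠ 0 := by
  by_contra! h
  have := M.det.ne_zero
  rw [Matrix.GeneralLinearGroup.val_det_apply, Matrix.det_fin_two, h.1, h.2] at this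
  simp at this

theorem homography_mul {E : Type v} [Field E] [Algebra k E] {z : E} (hz : Transcendental k z)
    (M N : GL (Fin 2) k) : homography (M * N) z = homography M (homography N z) := by
  have h1 := linear_ne_zero hz (row_ne_zero N)
  have h2 := linear_ne_zero hz (row_ne_zero (M * N))
  simp only [homography, Matrix.GeneralLinearGroup.coe_mul, Matrix.mul_apply, Fin.sum_univ_two,
    map_add, map_mul] at h2 ⊢
  have h3 : algebraMap k E (M 1 0) * ((algebraMap k E (N 0 0) * z + algebraMap k E (N 0 1)) /
    (algebraMap k E (N 1 0) * z + algebraMap k E (N 1 1))) + algebraMap k E (M 1 1) ≠ 0 := by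
    intro h0
    rw [mul_div_assoc', div_add' _ _ _ h1, div_eq_zero_iff, or_iff_left h1] at h0
    apply h2
    linear_combination h0
  rw [div_eq_div_iff h2 h3]
  field_simp
  ring

theorem homography_inj {E : Type v} [Field E] [Algebra k E] {z : E} (hz : Transcendental k z)
    {M N : GL (Fin 2) k} (h : homography M z = homography N z) :
    Matrix.ProjGenLinGroup.mk M = Matrix.ProjGenLinGroup.mk N := by
  have h1 : homography (N⁻¹ * M) z = z := by
    rw [homography_mul hz, h, ← homography_mul hz, inv_mul_cancel, homography_one]
  obtain ⟨P, hP⟩ : ∃ P, P = N⁻¹ * M := ⟨_, rfl⟩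
  rw [← hP] at h1
  have h2 := linear_ne_zero hz (row_ne_zero P)
  rw [homography, div_eq_iff h2] at h1
  have hp : (Polynomial.C (P 1 0) * Polynomial.X ^ 2 + Polynomial.C (P 1 1 - P 0 0) * Polynomial.X
      - Polynomial.C (P 0 1) : Polynomial k) = 0 := by
    by_contra hne
    refine hz ⟨_, hne, ?_⟩
    simp only [map_add, map_sub, map_mul, Polynomial.aeval_C, Polynomial.aeval_X, map_pow]
    linear_combination -h1
  have c0 := congrArg (fun p => Polynomial.coeff p 0) hp
  have c1 := congrArg (fun p => Polynomial.coeff p 1) hp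
  have c2 := congrArg (fun p => Polynomial.coeff p 2) hp
  simp [Polynomial.coeff_C, Polynomial.coeff_X] at c0 c1 c2
  have hu : P 0 0 ≠ 0 := by
    intro h0
    have := row_ne_zero P
    rw [c2, sub_eq_zero.1 c1, h0] at this
    simp at this
  symm
  rw [Matrix.ProjGenLinGroup.mk_eq_mk_iff]
  refine ⟨Units.mk0 _ hu, ?_⟩
  have : P = Matrix.GeneralLinearGroup.scalar (Fin 2) (Units.mk0 _ hu) := by
    ext i j
    fin_cases i <;> fin_cases j <;> simp [c0, c2, sub_eq_zero.1 c1]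
  rw [← this, hP, mul_inv_cancel_left]

theorem pullback_homography (f : Bir k) (M : GL (Fin 2) k) (z : FunField k) :
    f.pullback (homography M z) = homography M (f.pullback z) := by
  simp [homography]

theorem transcendental_pullback (f : Bir k) {z : FunField k} (hz : Transcendental k z) :
    Transcendental k (f.pullback z) := by
  intro h
  apply hz
  exact (isAlgebraic_algHom_iff (f.pullback : FunField k →ₐ[k] FunField k)
    f.pullback.injective).1 h

/-- The Jonquières group `Bir_k(ℙ², π)` of the birational maps `f` that preserve the fibration:
`π ∘ f = M ∘ π` for some homography `M`. -/
def jonquieres (p : RationalFibration k) : Subgroup (Bir k) where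
  carrier := {f | ∃ M : GL (Fin 2) k, f.pullback p.fn = homography M p.fn}
  one_mem' := ⟨1, by rw [homography_one, Bir.pullback_one]⟩
  mul_mem' := by
    rintro f g ⟨M, hM⟩ ⟨N, hN⟩
    exact ⟨M * N, by rw [Bir.pullback_mul, hM, pullback_homography, hN,
      homography_mul p.dominant]⟩
  inv_mem' := by
    rintro f ⟨M, hM⟩
    refine ⟨M⁻¹, ?_⟩
    have h1 : p.fn = homography M (f⁻¹.pullback p.fn) := by
      rw [← pullback_homography, ← hM, ← Bir.pullback_mul, mul_inv_cancel, Bir.pullback_one]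
    conv_rhs => rw [h1]
    rw [← homography_mul (transcendental_pullback f⁻¹ p.dominant), inv_mul_cancel,
      homography_one]

/-- The homomorphism `Bir_k(ℙ², π) → Aut_k(ℙ¹) = PGL₂(k)` sending `f` to the (unique) automorphism
`α` such that `π ∘ f = α ∘ π`. -/
def baseAction (p : RationalFibration k) : jonquieres p →* PGL(2, k) where
  toFun f := Matrix.ProjGenLinGroup.mk f.2.choose
  map_one' := by
    rw [← map_one Matrix.ProjGenLinGroup.mk]
    apply homography_inj p.dominant
    rw [← (1 : jonquieres p).2.choose_spec, homography_one]
    rfl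
  map_mul' f g := by
    rw [← map_mul]
    apply homography_inj p.dominant
    rw [← (f * g).2.choose_spec, homography_mul p.dominant, ← g.2.choose_spec,
      ← pullback_homography, ← f.2.choose_spec]
    rfl

theorem baseAction_eq_mk_iff (p : RationalFibration k) (f : jonquieres p) (M : GL (Fin 2) k) :
    baseAction p f = Matrix.ProjGenLinGroup.mk M ↔
      (f : Bir k).pullback p.fn = homography M p.fn := by
  constructor
  · intro h
    obtain ⟨u, hu⟩ := Matrix.ProjGenLinGroup.mk_eq_mk_iff.1 h
    rw [f.2.choose_spec, ← hu]
    have hu0 : algebraMap k (FunField k) u ≠ 0 := by simp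
    have h2 := linear_ne_zero p.dominant (row_ne_zero f.2.choose)
    simp only [homography, Matrix.GeneralLinearGroup.coe_mul, Matrix.mul_apply, Fin.sum_univ_two,
      map_add, map_mul]
    simp
    rw [mul_right_comm, ← add_mul, mul_right_comm, ← add_mul, mul_div_mul_right _ _ hu0]
  · intro h
    apply homography_inj p.dominant
    rw [← f.2.choose_spec, h]

/-- The image `Aut_k^π(ℙ¹)` of `Bir_k(ℙ², π)` in `Aut_k(ℙ¹) = PGL₂(k)`. -/
def autBase (p : RationalFibration k) : Subgroup PGL(2, k) := (baseAction p).range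

end Fibrations

/-! ### The fibration by conics through two `2`-points -/

section Conics

variable {k : Type u} [Field k]

/-- The numerator `(x - a₁ y)(x - a₂ y) + (x - b₁ z)(x - b₂ z) - x²` of the pencil of conics through
`[aᵢ : 1 : 0]` and `[bᵢ : 0 : 1]`, where `P = (T - a₁)(T - a₂)` and `Q = (T - b₁)(T - b₂)` are monic
polynomials of degree two over `k`.  The coordinates are `x = X₀`, `y = X₁`, `z = X₂`. -/
def conicNum (P Q : Polynomial k) : MvPolynomial (Fin 3) k :=
  (.X 0 ^ 2 + .C (P.coeff 1) * .X 0 * .X 1 + .C (P.coeff 0) * .X 1 ^ 2)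
    + (.X 0 ^ 2 + .C (Q.coeff 1) * .X 0 * .X 2 + .C (Q.coeff 0) * .X 2 ^ 2) - .X 0 ^ 2

/-- The denominator `y z` of the pencil. -/
def conicDen (k : Type u) [Field k] : MvPolynomial (Fin 3) k := .X 1 * .X 2

/-- The restriction of a ternary form to the chart `(x, y) ↦ [x : y : 1]`. -/
def dehomogenize (p : MvPolynomial (Fin 3) k) : FunField k :=
  MvPolynomial.aeval ![coord k 0, coord k 1, 1] p

theorem coord_ne_zero (i : Fin 2) : coord k i ≠ 0 :=
  algebraicIndependent_coord.ne_zero i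

theorem isIntegral_of_quadratic {A B : Type*} [CommRing A] [CommRing B] [Algebra A B] {z : B}
    (a b : A) (h : z ^ 2 + algebraMap A B a * z + algebraMap A B b = 0) : IsIntegral A z := by
  refine ⟨Polynomial.X ^ 2 + (Polynomial.C a * Polynomial.X + Polynomial.C b), ?_, ?_⟩
  · apply Polynomial.monic_X_pow_add
    exact lt_of_le_of_lt Polynomial.degree_linear_le (by norm_num)
  · rw [← h]
    simp [add_assoc]

theorem transcendental_conic (P Q : Polynomial k) :
    Transcendental k (dehomogenize (conicNum P Q) / dehomogenize (conicDen k)) := by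
  set w := dehomogenize (conicNum P Q) / dehomogenize (conicDen k) with hw
  have hy : coord k 1 ≠ 0 := coord_ne_zero 1
  set c := algebraMap k (FunField k) with hc
  have hrel : coord k 0 ^ 2 + (c (P.coeff 1) * coord k 1 + c (Q.coeff 1)) * coord k 0
      + (c (P.coeff 0) * coord k 1 ^ 2 + c (Q.coeff 0) - w * coord k 1) = 0 := by
    have : w * coord k 1 = dehomogenize (conicNum P Q) := by
      rw [hw]
      simp [dehomogenize, conicDen, hy]
    rw [this]
    simp [dehomogenize, conicNum, hc]
    ring
  let f : Fin 2 → FunField k := ![w, coord k 1]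
  let A := Algebra.adjoin k (Set.range f)
  have hwA : w ∈ A := Algebra.subset_adjoin ⟨0, rfl⟩
  have hyA : coord k 1 ∈ A := Algebra.subset_adjoin ⟨1, rfl⟩
  have hx : IsIntegral A (coord k 0) := by
    refine isIntegral_of_quadratic
      (algebraMap k A (P.coeff 1) * ⟨_, hyA⟩ + algebraMap k A (Q.coeff 1))
      (algebraMap k A (P.coeff 0) * ⟨_, hyA⟩ ^ 2 + algebraMap k A (Q.coeff 0)
        - ⟨_, hwA⟩ * ⟨_, hyA⟩) ?_
    exact hrel
  have halg : Algebra.IsAlgebraic A (FunField k) := by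
    let D : IntermediateField k (FunField k) :=
      { carrier := {z | IsAlgebraic A z}
        mul_mem' := fun h h' => IsAlgebraic.mul h h'
        add_mem' := fun h h' => IsAlgebraic.add h h'
        inv_mem' := fun _ h => IsAlgebraic.inv h
        algebraMap_mem' := fun r => isAlgebraic_algebraMap (algebraMap k A r) }
    have : (⊤ : IntermediateField k (FunField k)) ≤ D := by
      rw [← adjoin_coord, IntermediateField.adjoin_le_iff]
      rintro _ ⟨i, rfl⟩
      fin_cases i
      · exact hx.isAlgebraic
      · exact isAlgebraic_algebraMap (⟨_, hyA⟩ : A)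
    exact ⟨fun z => this (IntermediateField.mem_top (x := z))⟩
  exact (algebraicIndependent_of_algebraic f halg).transcendental 0

/-- The fibration `[x : y : z] ↦ [(x - a₁ y)(x - a₂ y) + (x - b₁ z)(x - b₂ z) - x² : y z]` given by the
pencil of conics through the four points `[aᵢ : 1 : 0]` and `[bᵢ : 0 : 1]`. -/
def conicFibration (P Q : Polynomial k) : RationalFibration k where
  fn := dehomogenize (conicNum P Q) / dehomogenize (conicDen k)
  dominant := transcendental_conic P Q

end Conics

/-! ### The explicit maps -/

section Maps

variable {K : Type v} [Field K]

theorem adjoin_eq_top_of_coord_mem {f : Fin 2 → FunField K}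
    (h : ∀ i, coord K i ∈ IntermediateField.adjoin K (Set.range f)) :
    IntermediateField.adjoin K (Set.range f) = ⊤ := by
  rw [eq_top_iff, ← adjoin_coord, IntermediateField.adjoin_le_iff]
  rintro _ ⟨i, rfl⟩
  exact h i

/-- The map `α(x, y) = (x - s y, x - s' y)`. -/
def alphaMap (s s' : K) (h : s ≠ s') : Bir K :=
  Bir.ofCoords
    ![coord K 0 - algebraMap K _ s * coord K 1, coord K 0 - algebraMap K _ s' * coord K 1] <| by
    set f : Fin 2 → FunField K := ![coord K 0 - algebraMap K _ s * coord K 1,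
      coord K 0 - algebraMap K _ s' * coord K 1] with hf
    set S := IntermediateField.adjoin K (Set.range f)
    have h0 : f 0 ∈ S := IntermediateField.subset_adjoin _ _ ⟨0, rfl⟩
    have h1 : f 1 ∈ S := IntermediateField.subset_adjoin _ _ ⟨1, rfl⟩
    have hc (a : K) : algebraMap K (FunField K) a ∈ S := S.algebraMap_mem a
    have hne : algebraMap K (FunField K) s' - algebraMap K (FunField K) s ≠ 0 := by
      rw [← map_sub, map_ne_zero]; exact sub_ne_zero.2 h.symm
    have hy : coord K 1 ∈ S := by
      have : coord K 1 = (f 0 - f 1) / (algebraMap K (FunField K) s' - algebraMap K _ s) := by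
        rw [eq_div_iff hne]; simp [hf]; ring
      rw [this]
      exact div_mem (sub_mem h0 h1) (sub_mem (hc _) (hc _))
    have hx : coord K 0 ∈ S := by
      have : coord K 0 = f 0 + algebraMap K _ s * coord K 1 := by simp [hf]
      rw [this]
      exact add_mem h0 (mul_mem (hc _) hy)
    apply adjoin_eq_top_of_coord_mem
    intro i
    fin_cases i
    exacts [hx, hy]

theorem coord_ne_const (i : Fin 2) (t : K) : coord K i ≠ algebraMap K _ t := by
  intro h
  exact algebraicIndependent_coord.transcendental i (h ▸ isAlgebraic_algebraMap t)

theorem mem_of_homography {S : IntermediateField K (FunField K)} {t t' : K} (h : t ≠ t')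
    (i : Fin 2)
    (hS : (coord K i - algebraMap K _ t) / (-coord K i + algebraMap K _ t') ∈ S) :
    coord K i ∈ S := by
  set w := (coord K i - algebraMap K _ t) / (-coord K i + algebraMap K _ t') with hw
  have h1 : -coord K i + algebraMap K (FunField K) t' ≠ 0 := by
    intro h0
    exact coord_ne_const i t' (neg_add_eq_zero.1 h0)
  have h2 : w + 1 ≠ 0 := by
    rw [hw, div_add_one h1]
    refine div_ne_zero ?_ h1
    rw [show coord K i - algebraMap K _ t + (-coord K i + algebraMap K (FunField K) t')
      = algebraMap K _ (t' - t) by rw [map_sub]; ring]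
    rw [map_ne_zero]
    exact sub_ne_zero.2 h.symm
  have h3 : coord K i = (algebraMap K _ t' * w + algebraMap K _ t) / (w + 1) := by
    rw [eq_div_iff h2, hw]
    field_simp
    ring
  rw [h3]
  exact div_mem (add_mem (mul_mem (S.algebraMap_mem _) hS) (S.algebraMap_mem _))
    (add_mem hS (one_mem S))

/-- The map `β(x, y) = ((x - t) / (-x + t'), (y - t') / (-y + t))`. -/
def betaMap (t t' : K) (h : t ≠ t') : Bir K :=
  Bir.ofCoords
    ![(coord K 0 - algebraMap K _ t) / (-coord K 0 + algebraMap K _ t'),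
      (coord K 1 - algebraMap K _ t') / (-coord K 1 + algebraMap K _ t)] <| by
    apply adjoin_eq_top_of_coord_mem
    intro i
    fin_cases i
    · exact mem_of_homography h 0 (IntermediateField.subset_adjoin _ _ ⟨0, rfl⟩)
    · exact mem_of_homography h.symm 1 (IntermediateField.subset_adjoin _ _ ⟨1, rfl⟩)

/-- The map `γ(x, y) = (x y, y)`. -/
def gammaMap (K : Type v) [Field K] : Bir K :=
  Bir.ofCoords ![coord K 0 * coord K 1, coord K 1] <| by
    set f : Fin 2 → FunField K := ![coord K 0 * coord K 1, coord K 1] with hf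
    set S := IntermediateField.adjoin K (Set.range f)
    have h0 : f 0 ∈ S := IntermediateField.subset_adjoin _ _ ⟨0, rfl⟩
    have h1 : f 1 ∈ S := IntermediateField.subset_adjoin _ _ ⟨1, rfl⟩
    apply adjoin_eq_top_of_coord_mem
    intro i
    fin_cases i
    · have : coord K 0 = f 0 / f 1 := by
        simp [hf, coord_ne_zero (k := K) 1]
      change coord K 0 ∈ S
      rw [this]
      exact div_mem h0 h1
    · exact h1

/-- The map `(x, y) ↦ (1 / (m x), 1 / (l y))`. -/
def invMap (m l : Kˣ) : Bir K :=
  Bir.ofCoords ![1 / (algebraMap K _ m * coord K 0), 1 / (algebraMap K _ l * coord K 1)] <| by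
    have key : ∀ (S : IntermediateField K (FunField K)) (a : Kˣ) (i : Fin 2),
        1 / (algebraMap K _ (a : K) * coord K i) ∈ S → coord K i ∈ S := by
      intro S a i h
      have ha : algebraMap K (FunField K) (a : K) ≠ 0 := by simp
      have : coord K i = (algebraMap K _ (a : K) *
          (1 / (algebraMap K _ (a : K) * coord K i)))⁻¹ := by
        have := coord_ne_zero (k := K) i
        field_simp
      rw [this]
      exact inv_mem (mul_mem (S.algebraMap_mem _) h)
    apply adjoin_eq_top_of_coord_mem
    intro i
    fin_cases i
    · exact key _ m 0 (IntermediateField.subset_adjoin _ _ ⟨0, rfl⟩)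
    · exact key _ l 1 (IntermediateField.subset_adjoin _ _ ⟨1, rfl⟩)

end Maps

/-! ### The set-up: two quadratic extensions -/

/-- Two quadratic extensions `L = k(θ)` and `L' = k(θ')` with composite field `K = L L'`, and:
* if `L = L'`, the generator `g` of `Gal(K/k)` (then `h`, `h'` play no role);
* if `L ≠ L'`, the generators `h` of `Gal(L/k)` and `h'` of `Gal(L'/k)`, seen in
  `Gal(K/k) = Gal(L/k) × Gal(L'/k)` (so `h` is trivial on `L'` and `h'` is trivial on `L`),
  and `g = h h'`. -/
structure SetUp (k : Type u) [Field k] (K : Type v) [Field K] [Algebra k K] where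
  L : IntermediateField k K
  L' : IntermediateField k K
  finrank_L : Module.finrank k L = 2
  finrank_L' : Module.finrank k L' = 2
  composite : L ⊔ L' = ⊤
  θ : K
  θ' : K
  adjoin_θ : k⟮θ⟯ = L
  adjoin_θ' : k⟮θ'⟯ = L'
  g : K ≃ₐ[k] K
  h : K ≃ₐ[k] K
  h' : K ≃ₐ[k] K
  of_eq : L = L' → g ≠ 1
  of_ne : L ≠ L' → (h ≠ 1 ∧ ∀ z ∈ L', h z = z) ∧ (h' ≠ 1 ∧ ∀ z ∈ L, h' z = z) ∧ g = h * h'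

namespace SetUp

variable {k : Type u} [Field k] {K : Type v} [Field K] [Algebra k K] (S : SetUp k K)

theorem eq_one_of_fix {σ : K ≃ₐ[k] K} (h1 : σ S.θ = S.θ) (h2 : σ S.θ' = S.θ') : σ = 1 := by
  have key : (⊤ : IntermediateField k K) ≤ IntermediateField.fixedField (Subgroup.zpowers σ) := by
    have fix : ∀ z, σ z = z → z ∈ IntermediateField.fixedField (Subgroup.zpowers σ) := by
      intro z hz
      rw [IntermediateField.mem_fixedField_iff]
      intro τ hτ
      have : Subgroup.zpowers σ ≤ MulAction.stabilizer (K ≃ₐ[k] K) z := by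
        rw [Subgroup.zpowers_le]; exact hz
      exact this hτ
    rw [← S.composite, ← S.adjoin_θ, ← S.adjoin_θ', sup_le_iff,
      IntermediateField.adjoin_simple_le_iff, IntermediateField.adjoin_simple_le_iff]
    exact ⟨fix _ h1, fix _ h2⟩
  ext z
  exact (IntermediateField.mem_fixedField_iff _ _).1 (key (IntermediateField.mem_top (x := z))) σ
    (Subgroup.mem_zpowers σ)

theorem θ_mem : S.θ ∈ S.L := S.adjoin_θ ▸ IntermediateField.mem_adjoin_simple_self k S.θ

theorem θ'_mem : S.θ' ∈ S.L' := S.adjoin_θ' ▸ IntermediateField.mem_adjoin_simple_self k S.θ'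

theorem fix_adjoin {σ : K ≃ₐ[k] K} {a b : K} (ha : σ a = a) (hb : b ∈ k⟮a⟯) : σ b = b := by
  have : k⟮a⟯ ≤ IntermediateField.fixedField (Subgroup.zpowers σ) := by
    rw [IntermediateField.adjoin_simple_le_iff, IntermediateField.mem_fixedField_iff]
    intro τ hτ
    have : Subgroup.zpowers σ ≤ MulAction.stabilizer (K ≃ₐ[k] K) a := by
      rw [Subgroup.zpowers_le]; exact ha
    exact this hτ
  exact (IntermediateField.mem_fixedField_iff _ _).1 (this hb) σ (Subgroup.mem_zpowers σ)

theorem g_θ_ne : S.θ ≠ S.g S.θ := by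
  intro h0
  by_cases hL : S.L = S.L'
  · refine S.of_eq hL (S.eq_one_of_fix h0.symm (fix_adjoin h0.symm ?_))
    rw [S.adjoin_θ, hL]
    exact S.θ'_mem
  · obtain ⟨⟨hh, hh2⟩, ⟨-, hh2'⟩, hg⟩ := S.of_ne hL
    rw [hg, AlgEquiv.mul_apply, hh2' _ S.θ_mem] at h0
    exact hh (S.eq_one_of_fix h0.symm (hh2 _ S.θ'_mem))

theorem g_θ'_ne : S.θ' ≠ S.g S.θ' := by
  intro h0
  by_cases hL : S.L = S.L'
  · refine S.of_eq hL (S.eq_one_of_fix (fix_adjoin h0.symm ?_) h0.symm)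
    rw [S.adjoin_θ', ← hL]
    exact S.θ_mem
  · obtain ⟨⟨hh, hh2⟩, ⟨hh', hh2'⟩, hg⟩ := S.of_ne hL
    rw [hg, AlgEquiv.mul_apply] at h0
    refine hh' (S.eq_one_of_fix (hh2' _ S.θ_mem) (S.h.injective ?_))
    rw [← h0, hh2 _ S.θ'_mem]

/-- The map `ε = γ ∘ β ∘ α : ℙ² ⇢ ℙ¹ × ℙ¹`, in the affine charts, where
`α(x, y) = (x - θ' y, x - θ'^g y)`, `β(x, y) = ((x - θ) / (-x + θ^g), (y - θ^g) / (-y + θ))`,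
`γ(x, y) = (x y, y)`. -/
def ε : Bir K :=
  gammaMap K * betaMap S.θ (S.g S.θ) S.g_θ_ne * alphaMap S.θ' (S.g S.θ') S.g_θ'_ne

/-- The fibration `π_{L,L'}` given by the pencil of conics through the `2`-points
`{[θ' : 1 : 0], [θ'^g : 1 : 0]}` and `{[θ : 0 : 1], [θ^g : 0 : 1]}`. -/
def fibration : RationalFibration k := conicFibration (minpoly k S.θ') (minpoly k S.θ)

/-- The maps `(x, y) ↦ (1 / (μ x), 1 / (λ y))` with `μ = λ λ^g`, where `λ ∈ Kˣ`, and moreover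
`λ λ^h = 1` if `L ≠ L'`. -/
def involutions : Set (Bir K) :=
  {f | ∃ l m : Kˣ, (m : K) = l * S.g l ∧ (S.L ≠ S.L' → (l : K) * S.h l = 1) ∧ f = invMap m l}

/-- The group `H_{L,L'}` generated by these maps. -/
def H : Subgroup (Bir K) := Subgroup.closure S.involutions

/-- The group `ε⁻¹ H_{L,L'} ε`. -/
def conjH : Subgroup (Bir K) := S.H.map (MulAut.conj S.ε⁻¹).toMonoidHom

end SetUp

end Jonq22

end

noncomputable section

namespace Jonq22

universe u v

/-! ### The coefficientwise Galois action on `K(x, y)`, and norms for it -/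

section Twist

variable {K : Type v} [Field K]

/-! Let t be the fibre coordinate and (A, B) the coordinates of ε. Put c₁ = θ^g θ' + θ θ'^g and c₂ =
θ θ' + θ^g θ'^g; the pencil has pairs of conjugate lines over t = -c₁ and t = -c₂. Then A = (t +
c₁)/(t + c₂) (`fstε_eq_fiberFn`), so over K the function A is a coordinate of the base, while A =
B·B^g is a norm. If L ≠ L', then also B·B^h = 1 and A·A^h = 1.

Inclusion: the map (A, B) ↦ (1/(μA), 1/(λB)) commutes with these twisted Galois actions exactly
because μ = λλ^g and, if L ≠ L', λλ^h = 1 (`twist_conj_invMap`). By Galois descent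
(`exists_baseChange_eq`) it is defined over k, and solving A ↦ 1/(μA) for t gives a homography with
Galois-invariant coefficients (`conj_invMap_mem`).

Surjectivity: let f over k preserve the fibration. Then f^*A is a homography of t and still a norm,
f^*B·(f^*B)^g. Its zero must be -c₁ or -c₂: any other fibre is given in the chart by a g-invariant
prime polynomial, which would occur exactly once in f^*A but has even multiplicity in a norm
(`div_ne_mul_twist`). The same holds for the pole, so f^*A is nA or n/A with n constant
(`pullback_fstε_cases`). Now f^*B/B, respectively f^*B·B, has g-norm n and, if L ≠ L', h-norm 1.
Taking lexicographic leading coefficients (`exists_const_of_mul_twist_eq`) turns it into a constant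
λ with the same norms, and λ yields an element of H acting on A, hence on t, as f does. -/

theorem ringHom_ext_coord {E : Type*} [Field E] {f g : FunField K →+* E}
    (hc : ∀ a : K, f (algebraMap K _ a) = g (algebraMap K _ a))
    (h : ∀ i, f (coord K i) = g (coord K i)) : f = g := by
  -- Twists are only semilinear, so K is made to act on the target through f itself; `hc` then makes
  -- g linear too.
  let _ : Algebra K E := (f.comp (algebraMap K (FunField K))).toAlgebra
  let f' : FunField K →ₐ[K] E := { f with commutes' := fun _ => rfl }
  let g' : FunField K →ₐ[K] E := { g with commutes' := fun a => (hc a).symm }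
  have : f' = g' := algHom_ext_coord h
  ext z
  exact DFunLike.congr_fun this z

/-- The action of a field automorphism of `K` on the coefficients of the elements of `K(x, y)`. -/
def twist (σ : K ≃+* K) : FunField K →+* FunField K :=
  IsFractionRing.map (A := MvPolynomial (Fin 2) K) (B := MvPolynomial (Fin 2) K)
    (j := MvPolynomial.map (σ : K →+* K)) (MvPolynomial.map_injective _ σ.injective)

theorem twist_algebraMap (σ : K ≃+* K) (p : MvPolynomial (Fin 2) K) :
    twist σ (algebraMap _ _ p) = algebraMap _ _ (MvPolynomial.map (σ : K →+* K) p) := by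
  unfold twist IsFractionRing.map
  rw [IsLocalization.map_eq]

theorem algebraMap_C (a : K) :
    algebraMap (MvPolynomial (Fin 2) K) (FunField K) (MvPolynomial.C a) = algebraMap K _ a := by
  rw [IsScalarTower.algebraMap_apply K (MvPolynomial (Fin 2) K) (FunField K)]; rfl

@[simp]
theorem twist_const (σ : K ≃+* K) (a : K) :
    twist σ (algebraMap K _ a) = algebraMap K _ (σ a) := by
  rw [← algebraMap_C, twist_algebraMap, MvPolynomial.map_C, algebraMap_C]; rfl

@[simp]
theorem twist_coord (σ : K ≃+* K) (i : Fin 2) : twist σ (coord K i) = coord K i := by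
  rw [coord, twist_algebraMap, MvPolynomial.map_X]

theorem twist_twist (σ τ : K ≃+* K) (z : FunField K) :
    twist σ (twist τ z) = twist (τ.trans σ) z := by
  have : (twist σ).comp (twist τ) = twist (τ.trans σ) := by
    apply ringHom_ext_coord <;> intros <;> simp
  exact DFunLike.congr_fun this z

/-- The leading coefficient (for the lexicographic order) is a multiplicative retraction of
`K(x, y)ˣ` onto `Kˣ` which is compatible with automorphisms of `K`. -/
theorem exists_const_of_mul_twist_eq {z : FunField K} (hz : z ≠ 0) :
    ∃ l : K, l ≠ 0 ∧ ∀ (σ : K ≃+* K) (c : K), z * twist σ z = algebraMap K _ c →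
      l * σ l = c := by
  obtain ⟨p, q, hq, rfl⟩ := IsFractionRing.div_surjective (MvPolynomial (Fin 2) K) z
  let m : MonomialOrder (Fin 2) := MonomialOrder.lex
  have hlm (σ : K ≃+* K) (r : MvPolynomial (Fin 2) K) :
      m.leadingCoeff (MvPolynomial.map (σ : K →+* K) r) = σ (m.leadingCoeff r) := by
    -- The leading monomial depends only on the support, which σ preserves.
    have hd : m.degree (MvPolynomial.map (σ : K →+* K) r) = m.degree r := by
      unfold MonomialOrder.degree
      rw [MvPolynomial.support_map_of_injective _ σ.injective]
    rw [MonomialOrder.leadingCoeff, hd, MvPolynomial.coeff_map]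
    rfl
  have hq0 : q ≠ 0 := nonZeroDivisors.ne_zero hq
  have hp0 : p ≠ 0 := by rintro rfl; simp at hz
  have hlp := m.leadingCoeff_ne_zero_iff.2 hp0
  have hlq := m.leadingCoeff_ne_zero_iff.2 hq0
  refine ⟨m.leadingCoeff p / m.leadingCoeff q, div_ne_zero hlp hlq, fun σ c h => ?_⟩
  have inj := IsFractionRing.injective (MvPolynomial (Fin 2) K) (FunField K)
  have hq1 : algebraMap (MvPolynomial (Fin 2) K) (FunField K) q ≠ 0 :=
    (map_ne_zero_iff _ inj).2 hq0
  have hq2 : algebraMap (MvPolynomial (Fin 2) K) (FunField K)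
      (MvPolynomial.map (σ : K →+* K) q) ≠ 0 :=
    (map_ne_zero_iff _ inj).2 ((map_ne_zero_iff _ (MvPolynomial.map_injective _ σ.injective)).2 hq0)
  rw [map_div₀, twist_algebraMap, twist_algebraMap, div_mul_div_comm,
    div_eq_iff (mul_ne_zero hq1 hq2), ← algebraMap_C, ← map_mul, ← map_mul, ← map_mul] at h
  have h' := congrArg m.leadingCoeff (inj h)
  rw [MonomialOrder.leadingCoeff_mul, MonomialOrder.leadingCoeff_mul,
    MonomialOrder.leadingCoeff_mul, MonomialOrder.leadingCoeff_C, hlm, hlm] at h'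
  have : σ (m.leadingCoeff q) ≠ 0 := by simpa using hlq
  rw [map_div₀, div_mul_div_comm, div_eq_iff (mul_ne_zero hlq this), h']

/-- An invariant prime polynomial has even multiplicity in a norm. -/
theorem div_ne_mul_twist {σ : K ≃+* K} {p q : MvPolynomial (Fin 2) K} (hp : Prime p)
    (hσ : MvPolynomial.map (σ : K →+* K) p = p) (hq : ¬ p ∣ q) (z : FunField K) :
    algebraMap _ (FunField K) p / algebraMap _ (FunField K) q ≠ z * twist σ z := by
  intro h
  obtain ⟨a, b, hb, rfl⟩ := IsFractionRing.div_surjective (MvPolynomial (Fin 2) K) z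
  have hmul (r : MvPolynomial (Fin 2) K) :
      emultiplicity p (MvPolynomial.map (σ : K →+* K) r) = emultiplicity p r := by
    -- Writing p as its own image turns the claim into invariance of multiplicity under a ring
    -- automorphism.
    conv_lhs => rw [← hσ]
    exact emultiplicity_map_eq (MvPolynomial.mapEquiv (Fin 2) σ)
  have inj := IsFractionRing.injective (MvPolynomial (Fin 2) K) (FunField K)
  have injσ := MvPolynomial.map_injective (σ := Fin 2) (σ : K →+* K) σ.injective
  have hq0 : q ≠ 0 := by rintro rfl; simp at hq
  have hb0 : b ≠ 0 := nonZeroDivisors.ne_zero hb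
  have hq1 := (map_ne_zero_iff _ inj).2 hq0
  have hb1 := (map_ne_zero_iff _ inj).2 hb0
  have hb2 := (map_ne_zero_iff _ inj).2 ((map_ne_zero_iff _ injσ).2 hb0)
  rw [map_div₀, twist_algebraMap, twist_algebraMap, div_mul_div_comm,
    div_eq_div_iff hq1 (mul_ne_zero hb1 hb2), ← map_mul, ← map_mul, ← map_mul, ← map_mul] at h
  have h0 := inj h
  have ha0 : a ≠ 0 := by
    rintro rfl
    simp [hp.ne_zero, hb0, (map_ne_zero_iff _ injσ).2 hb0] at h0
  -- With v the multiplicity of p, this reads 1 + 2v(b) = 2v(a), which fails by parity.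
  have h' := congrArg (emultiplicity p) h0
  rw [emultiplicity_mul hp, emultiplicity_mul hp, emultiplicity_mul hp, emultiplicity_mul hp,
    hmul, hmul, emultiplicity_eq_zero.2 hq, add_zero] at h'
  have hfin {r : MvPolynomial (Fin 2) K} (hr : r ≠ 0) : FiniteMultiplicity p r :=
    FiniteMultiplicity.of_prime_left hp hr
  rw [(hfin hp.ne_zero).emultiplicity_eq_multiplicity, (hfin hb0).emultiplicity_eq_multiplicity,
    (hfin ha0).emultiplicity_eq_multiplicity, multiplicity_self] at h'
  norm_cast at h'
  omega

end Twist

/-! ### Irreducibility of the members of the pencil of conics -/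

section Pencil

variable {K : Type v} [Field K]

open MvPolynomial in
/-- The equation of a member of the pencil of conics, in the chart `z = 1`:
`a ((x - s y)(x - s' y) + (x - t)(x - t') - x²) + b y`. -/
def pencil (s s' t t' a b : K) : MvPolynomial (Fin 2) K :=
  C a * ((X 0 - C s * X 1) * (X 0 - C s' * X 1) - C (t + t') * X 0 + C (t * t')) + C b * X 1

theorem map_pencil (σ : K ≃+* K) {s s' t t' a b : K} (hs : σ s = s') (hs' : σ s' = s)
    (ht : σ t = t') (ht' : σ t' = t) (ha : σ a = a) (hb : σ b = b) :
    MvPolynomial.map (σ : K →+* K) (pencil s s' t t' a b) = pencil s s' t t' a b := by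
  simp [pencil, hs, hs', ht, ht', ha, hb]
  left
  ring

open MvPolynomial in
/-- A linear change of coordinates. -/
def linearChange (s s' : K) (h : s ≠ s') : MvPolynomial (Fin 2) K ≃ₐ[K] MvPolynomial (Fin 2) K :=
  AlgEquiv.ofAlgHom (aeval ![X 0 - C s * X 1, X 0 - C s' * X 1])
    (aeval ![C (s' / (s' - s)) * X 0 - C (s / (s' - s)) * X 1,
      C (1 / (s' - s)) * X 0 - C (1 / (s' - s)) * X 1])
    (by
      have h0 : s' - s ≠ 0 := sub_ne_zero.2 h.symm
      have h1 : (C (s' / (s' - s)) - C (s / (s' - s)) : MvPolynomial (Fin 2) K) = 1 := by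
        rw [← C_sub, ← sub_div, div_self h0, C_1]
      have h2 : (C (1 / (s' - s)) * (C s' - C s) : MvPolynomial (Fin 2) K) = 1 := by
        rw [← C_sub, ← C_mul, one_div_mul_cancel h0, C_1]
      have h3 (a : K) : (C (a / (s' - s)) : MvPolynomial (Fin 2) K) = C a * C (1 / (s' - s)) := by
        rw [← C_mul, mul_one_div]
      apply MvPolynomial.algHom_ext
      intro i
      fin_cases i
      · simp [algebraMap_eq]
        rw [h3 s', h3 s] at h1 ⊢
        linear_combination (X 0 : MvPolynomial (Fin 2) K) * h1
      · simp [algebraMap_eq]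
        rw [← one_div]
        linear_combination (X 1 : MvPolynomial (Fin 2) K) * h2)
    (by
      have h0 : s' - s ≠ 0 := sub_ne_zero.2 h.symm
      have h2 : (C (1 / (s' - s)) * (C s' - C s) : MvPolynomial (Fin 2) K) = 1 := by
        rw [← C_sub, ← C_mul, one_div_mul_cancel h0, C_1]
      have h3 (a : K) : (C (a / (s' - s)) : MvPolynomial (Fin 2) K) = C a * C (1 / (s' - s)) := by
        rw [← C_mul, mul_one_div]
      apply MvPolynomial.algHom_ext
      intro i
      fin_cases i
      · simp [algebraMap_eq]
        rw [h3 s', h3 s, ← one_div]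
        linear_combination (X 0 : MvPolynomial (Fin 2) K) * h2
      · simp [algebraMap_eq]
        rw [h3 s', h3 s, ← one_div]
        linear_combination (X 1 : MvPolynomial (Fin 2) K) * h2)

open MvPolynomial in
/-- A bilinear polynomial `u v + m v + n u + r` with `r ≠ n m` is irreducible. -/
theorem irreducible_bilinear {m n r : K} (h : r ≠ n * m) :
    Irreducible ((X 0 + C m) * X 1 + (C n * X 0 + C r) : MvPolynomial (Fin 2) K) := by
  have hv (a b : K) : (1 : Fin 2) ∉ (C a * X 0 + C b : MvPolynomial (Fin 2) K).vars := by
    intro h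
    have h1 := vars_add_subset _ _ h
    rw [vars_C, Finset.union_empty] at h1
    have h2 := vars_mul _ _ h1
    simp at h2
  apply irreducible_mul_X_add
  · intro h0
    have := congrArg (eval fun _ => 1 - m) h0
    simp at this
  · simpa using hv 1 m
  · exact hv n r
  · intro d hd hd'
    -- A common divisor of the two coefficients in the second variable divides their resultant, a
    -- nonzero constant.
    have : d ∣ C (r - n * m) := by
      have h1 : (C (r - n * m) : MvPolynomial (Fin 2) K) =
          (C n * X 0 + C r) - C n * (X 0 + C m) := by
        simp only [C_sub, C_mul]; ring
      rw [h1]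
      exact dvd_sub hd' (Dvd.dvd.mul_left hd _)
    refine isUnit_of_dvd_unit this ?_
    exact (isUnit_iff_ne_zero.2 (sub_ne_zero.2 h)).map C

open MvPolynomial in
/-- The smooth members of the pencil are irreducible. -/
theorem irreducible_pencil {s s' t t' b : K} (hs : s ≠ s') (h1 : b ≠ t' * s + t * s')
    (h2 : b ≠ t * s + t' * s') : Irreducible (pencil s s' t t' 1 b) := by
  have h0 : s' - s ≠ 0 := sub_ne_zero.2 hs.symm
  -- In u = x - s y, v = x - s' y the member is uv - (t + κ)v + (κ - t')u + tt'. It factors iff κ(κ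
  -- - (t' - t)) = 0, and the roots κ = 0 and κ = t' - t are the two excluded values of b.
  obtain ⟨κ, hκ⟩ : ∃ κ, b - (t' * s + t * s') = κ * (s' - s) :=
    ⟨(b - (t' * s + t * s')) / (s' - s), (div_mul_cancel₀ _ h0).symm⟩
  have key : pencil s s' t t' 1 b = linearChange s s' hs
      ((X 0 + C (-t - κ)) * X 1 + (C (-t' + κ) * X 0 + C (t * t'))) := by
    have hb : b = κ * (s' - s) + (t' * s + t * s') := by rw [← hκ]; ring
    rw [hb]
    simp [linearChange, pencil, algebraMap_eq]
    ring
  rw [key, MulEquiv.irreducible_iff]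
  apply irreducible_bilinear
  intro h
  have h3 : κ * (κ - (t' - t)) = 0 := by linear_combination h
  rcases mul_eq_zero.1 h3 with h3 | h3
  · rw [h3, zero_mul, sub_eq_zero] at hκ
    exact h1 hκ
  · rw [sub_eq_zero] at h3
    rw [h3] at hκ
    exact h2 (by linear_combination hκ)

theorem pencil_smul (s s' t t' a b c : K) :
    pencil s s' t t' (c * a) (c * b) = MvPolynomial.C c * pencil s s' t t' a b := by
  simp [pencil]
  ring

/-- Up to a unit, only the member a = 0 remains beyond the monic case. In this chart it is the line
y = 0, since the other component of yz = 0 lies at infinity. -/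
theorem prime_pencil {s s' t t' a b : K} (hs : s ≠ s') (h0 : a ≠ 0 ∨ b ≠ 0)
    (h1 : b ≠ a * (t' * s + t * s'))
    (h2 : b ≠ a * (t * s + t' * s')) : Prime (pencil s s' t t' a b) := by
  have hu {c : K} (hc : c ≠ 0) : IsUnit (MvPolynomial.C c : MvPolynomial (Fin 2) K) :=
    (isUnit_iff_ne_zero.2 hc).map MvPolynomial.C
  by_cases ha : a = 0
  · subst ha
    have hb : b ≠ 0 := by tauto
    have : pencil s s' t t' 0 b = MvPolynomial.C b * MvPolynomial.X 1 := by simp [pencil]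
    rw [this]
    exact (associated_unit_mul_right _ _ (hu hb)).prime MvPolynomial.X_prime
  · have : pencil s s' t t' a b = MvPolynomial.C a * pencil s s' t t' 1 (b / a) := by
      rw [← pencil_smul, mul_one, mul_div_cancel₀ _ ha]
    rw [this]
    refine (associated_unit_mul_right _ _ (hu ha)).prime (irreducible_pencil hs ?_ ?_).prime
    · rwa [Ne, div_eq_iff ha, mul_comm]
    · rwa [Ne, div_eq_iff ha, mul_comm]

/-- Two independent members span the pencil, so divisibility would make the prime divide every
member, in particular both y and the member (1, 0). Being associated to y, it would force y to
divide that member. -/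
theorem not_pencil_dvd {s s' t t' a b c d : K} (hp : Prime (pencil s s' t t' a b))
    (h : a * d - b * c ≠ 0) : ¬ pencil s s' t t' a b ∣ pencil s s' t t' c d := by
  intro hd
  have hu : IsUnit (MvPolynomial.C (a * d - b * c) : MvPolynomial (Fin 2) K) :=
    (isUnit_iff_ne_zero.2 h).map MvPolynomial.C
  have hy : pencil s s' t t' a b ∣ MvPolynomial.X 1 := by
    rw [← hu.dvd_mul_left]
    have : MvPolynomial.C (a * d - b * c) * MvPolynomial.X 1 =
        MvPolynomial.C a * pencil s s' t t' c d - MvPolynomial.C c * pencil s s' t t' a b := by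
      simp [pencil]; ring
    rw [this]
    exact dvd_sub (hd.mul_left _) (dvd_mul_left _ _)
  have hn : pencil s s' t t' a b ∣ pencil s s' t t' 1 0 := by
    rw [← hu.dvd_mul_left]
    have : MvPolynomial.C (a * d - b * c) * pencil s s' t t' 1 0 =
        MvPolynomial.C d * pencil s s' t t' a b - MvPolynomial.C b * pencil s s' t t' c d := by
      simp [pencil]; ring
    rw [this]
    exact dvd_sub (dvd_mul_left _ _) (hd.mul_left _)
  have hX : (MvPolynomial.X 1 : MvPolynomial (Fin 2) K) ∣ pencil s s' t t' 1 0 :=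
    ((hp.irreducible.associated_of_dvd MvPolynomial.X_prime.irreducible hy).symm.dvd).trans hn
  obtain ⟨q, hq⟩ := hX
  -- On the line y = 0 the member restricts to a polynomial in x with leading term x².
  have := congrArg (MvPolynomial.aeval (![Polynomial.X, 0] : Fin 2 → Polynomial K)) hq
  simp [pencil] at this
  have := congrArg (fun p => Polynomial.coeff p 2) this
  simp [← pow_two, ← Polynomial.C_add, ← Polynomial.C_mul, - map_add, -map_mul] at this

end Pencil

/-! ### Galois descent for functions and birational maps -/

section Descent

variable {k : Type u} [Field k] {K : Type v} [Field K] [Algebra k K]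

theorem scalarExt_algebraMap (p : MvPolynomial (Fin 2) k) :
    scalarExt k K (algebraMap _ _ p) =
      algebraMap _ _ (MvPolynomial.map (algebraMap k K) p) :=
  IsFractionRing.lift_algebraMap (K := FunField k)
    (g := ((IsScalarTower.toAlgHom k (MvPolynomial (Fin 2) K) (FunField K)).comp
      (MvPolynomial.mapAlgHom (Algebra.ofId k K))).toRingHom)
    ((IsFractionRing.injective (MvPolynomial (Fin 2) K) (FunField K)).comp
      (MvPolynomial.map_injective _ (algebraMap k K).injective)) p

theorem scalarExt_const (a : k) :
    scalarExt k K (algebraMap k _ a) = algebraMap K _ (algebraMap k K a) := by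
  rw [← algebraMap_C, scalarExt_algebraMap, MvPolynomial.map_C, algebraMap_C]

theorem twist_scalarExt (σ : K ≃ₐ[k] K) (z : FunField k) :
    twist (σ : K ≃+* K) (scalarExt k K z) = scalarExt k K z := by
  have : (twist (σ : K ≃+* K)).comp (scalarExt k K : FunField k →+* FunField K) =
      (scalarExt k K : FunField k →+* FunField K) := by
    apply ringHom_ext_coord
    · intro a
      change twist _ (scalarExt k K (algebraMap k _ a)) = scalarExt k K (algebraMap k _ a)
      rw [scalarExt_const, twist_const]
      simp
    · intro i
      simp [scalarExt_coord]
  exact DFunLike.congr_fun this z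

theorem twist_const_gal (σ : K ≃ₐ[k] K) (a : K) :
    twist (σ : K ≃+* K) (algebraMap K _ a) = algebraMap K _ (σ a) :=
  twist_const _ a

theorem twist_one (z : FunField K) : twist ((1 : K ≃ₐ[k] K) : K ≃+* K) z = z := by
  have : twist ((1 : K ≃ₐ[k] K) : K ≃+* K) = RingHom.id _ := by
    apply ringHom_ext_coord
    · intro a
      rw [twist_const_gal]
      rfl
    · intro i
      rw [twist_coord]
      rfl
  exact DFunLike.congr_fun this z

theorem pullback_const (f : Bir K) (a : K) :
    f.pullback (algebraMap K _ a) = algebraMap K _ a := f.pullback.commutes a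

theorem twist_pullback_baseChange (σ : K ≃ₐ[k] K) (f : Bir k) (z : FunField K) :
    twist (σ : K ≃+* K) ((baseChange k K f).pullback z) =
      (baseChange k K f).pullback (twist (σ : K ≃+* K) z) := by
  have : (twist (σ : K ≃+* K)).comp ((baseChange k K f).pullback : FunField K →+* FunField K) =
      ((baseChange k K f).pullback : FunField K →+* FunField K).comp (twist (σ : K ≃+* K)) := by
    apply ringHom_ext_coord
    · intro a
      simp
    · intro i
      simp only [RingHom.comp_apply, twist_coord, RingHom.coe_coe]
      rw [← scalarExt_coord k K i]
      erw [Bir.pullback_extend]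
      rw [twist_scalarExt]
  exact DFunLike.congr_fun this z

/-- Replace the denominator q by the product of its conjugates. It is invariant, hence so is the new
numerator, and an invariant polynomial has coefficients in k. -/
theorem exists_scalarExt_eq [FiniteDimensional k K] [IsGalois k K] {z : FunField K}
    (hz : ∀ σ : K ≃ₐ[k] K, twist (σ : K ≃+* K) z = z) : ∃ w, scalarExt k K w = z := by
  obtain ⟨p, q, hq, rfl⟩ := IsFractionRing.div_surjective (MvPolynomial (Fin 2) K) z
  have hq0 : q ≠ 0 := nonZeroDivisors.ne_zero hq
  have inj := IsFractionRing.injective (MvPolynomial (Fin 2) K) (FunField K)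
  have fixed : ∀ r : MvPolynomial (Fin 2) K,
      (∀ σ : K ≃ₐ[k] K, MvPolynomial.map ((σ : K ≃+* K) : K →+* K) r = r) →
      ∃ w, scalarExt k K w = algebraMap _ _ r := by
    intro r hr
    have : r ∈ Set.range (MvPolynomial.map (algebraMap k K) : MvPolynomial (Fin 2) k →+* _) := by
      rw [MvPolynomial.mem_range_map_iff_coeffs_subset]
      intro c hc
      rw [Finset.mem_coe, MvPolynomial.mem_coeffs_iff] at hc
      obtain ⟨n, -, rfl⟩ := hc
      have : r.coeff n ∈ (⊥ : IntermediateField k K) := by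
        rw [IsGalois.mem_bot_iff_fixed]
        intro σ
        conv_rhs => rw [← hr σ, MvPolynomial.coeff_map]
        rfl
      exact this
    obtain ⟨r0, rfl⟩ := this
    exact ⟨algebraMap _ _ r0, scalarExt_algebraMap r0⟩
  let d : MvPolynomial (Fin 2) K :=
    ∏ σ : K ≃ₐ[k] K, MvPolynomial.map ((σ : K ≃+* K) : K →+* K) q
  have hd : ∀ σ : K ≃ₐ[k] K, MvPolynomial.map ((σ : K ≃+* K) : K →+* K) d = d := by
    intro σ
    rw [map_prod]
    refine Fintype.prod_equiv (Equiv.mulLeft σ) _ _ fun τ => ?_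
    rw [MvPolynomial.map_map]
    rfl
  have hd0 : d ≠ 0 := by
    refine Finset.prod_ne_zero_iff.2 fun σ _ => ?_
    exact (map_ne_zero_iff _ (MvPolynomial.map_injective _ (RingHom.injective _))).2 hq0
  obtain ⟨e, he⟩ : q ∣ d := by
    have : MvPolynomial.map (((1 : K ≃ₐ[k] K) : K ≃+* K) : K →+* K) q = q :=
      MvPolynomial.map_id q
    conv_lhs => rw [← this]
    exact Finset.dvd_prod_of_mem _ (Finset.mem_univ _)
  have hq1 := (map_ne_zero_iff _ inj).2 hq0
  have hd1 := (map_ne_zero_iff _ inj).2 hd0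
  have hz' : algebraMap _ (FunField K) p / algebraMap _ (FunField K) q * algebraMap _ _ d =
      algebraMap _ _ (p * e) := by
    rw [he, map_mul, map_mul]
    field_simp
  obtain ⟨w1, h1⟩ := fixed (p * e) fun σ => by
    apply inj
    rw [← twist_algebraMap, ← hz', map_mul, hz, twist_algebraMap, hd]
  obtain ⟨w2, h2⟩ := fixed d hd
  refine ⟨w1 / w2, ?_⟩
  rw [map_div₀, h1, h2, ← hz', mul_div_cancel_right₀ _ hd1]

/-- A comorphism commuting with Galois, together with its inverse, preserves the invariant
functions, which are exactly k(x, y). Its restriction to them is the descended map. -/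
theorem exists_baseChange_eq [FiniteDimensional k K] [IsGalois k K] {f : Bir K}
    (hf : ∀ (σ : K ≃ₐ[k] K) (z : FunField K),
      twist (σ : K ≃+* K) (f.pullback z) = f.pullback (twist (σ : K ≃+* K) z)) :
    ∃ f₀, baseChange k K f₀ = f := by
  let e := AlgEquiv.ofInjectiveField (scalarExt k K)
  have he (z : FunField k) : (e z : FunField K) = scalarExt k K z := rfl
  have hr (z : FunField k) : f.pullback (scalarExt k K z) ∈ (scalarExt k K).range :=
    exists_scalarExt_eq fun σ => by rw [hf, twist_scalarExt]
  let φ : FunField k →ₐ[k] FunField k := (e.symm : _ →ₐ[k] FunField k).comp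
    (AlgHom.codRestrict
      (((f.pullback : FunField K →ₐ[K] FunField K).restrictScalars k).comp (scalarExt k K))
      (scalarExt k K).range hr)
  have hφ (z : FunField k) : scalarExt k K (φ z) = f.pullback (scalarExt k K z) := by
    rw [← he]
    change ((e (e.symm _) : (scalarExt k K).range) : FunField K) = _
    rw [AlgEquiv.apply_symm_apply]
    rfl
  have hφb : Function.Bijective φ := by
    refine ⟨φ.injective, fun z => ?_⟩
    obtain ⟨w, hw⟩ : ∃ w, scalarExt k K w = f.pullback.symm (scalarExt k K z) := by
      apply exists_scalarExt_eq
      intro σ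
      apply f.pullback.injective
      rw [← hf, AlgEquiv.apply_symm_apply, twist_scalarExt]
    refine ⟨w, (scalarExt k K).injective ?_⟩
    change scalarExt k K (φ w) = scalarExt k K z
    rw [hφ, hw, AlgEquiv.apply_symm_apply]
  refine ⟨MulOpposite.op (AlgEquiv.ofBijective φ hφb), ?_⟩
  apply Bir.ext_coord
  intro i
  rw [← scalarExt_coord k K i]
  erw [Bir.pullback_extend]
  exact hφ _

end Descent

/-! ### The Galois group of K over k and its action on θ and θ' -/

theorem minpoly_quadratic {k : Type u} [Field k] {K : Type v} [Field K] [Algebra k K] {x : K}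
    (hx : Module.finrank k k⟮x⟯ = 2) {σ : K ≃ₐ[k] K} (hσ : x ≠ σ x) :
    algebraMap k K ((minpoly k x).coeff 1) = -(x + σ x) ∧
      algebraMap k K ((minpoly k x).coeff 0) = x * σ x ∧
      ∀ τ : K ≃ₐ[k] K, τ x = x ∨ τ x = σ x := by
  have hfin : FiniteDimensional k k⟮x⟯ := Module.finite_of_finrank_eq_succ hx
  have hint : IsIntegral k x := by
    have := Algebra.IsIntegral.isIntegral (R := k) (IntermediateField.AdjoinSimple.gen k x)
    exact IntermediateField.AdjoinSimple.isIntegral_gen k x |>.1 this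
  rw [IntermediateField.adjoin.finrank hint] at hx
  have hm := minpoly.monic hint
  have hc : (minpoly k x).coeff 2 = 1 := by rw [← hx]; exact hm
  set p := minpoly k x with hp
  have hroot (τ : K ≃ₐ[k] K) :
      τ x ^ 2 + algebraMap k K (p.coeff 1) * τ x + algebraMap k K (p.coeff 0) = 0 := by
    have h := minpoly.aeval k x
    have h' := congrArg τ h
    rw [map_zero, ← Polynomial.aeval_algHom_apply τ, Polynomial.aeval_eq_sum_range, ← hp, hx] at h'
    simp only [Finset.sum_range_succ, Finset.sum_range_zero, hc, Algebra.smul_def] at h'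
    simp only [map_one] at h'
    linear_combination h'
  have h1 := hroot 1
  have h2 := hroot σ
  simp only [AlgEquiv.one_apply] at h1
  -- Vieta: x and σ x are distinct roots, so the difference of the two equations can be divided by x
  -- - σ x.
  have ha : algebraMap k K (p.coeff 1) = -(x + σ x) := by
    apply mul_left_cancel₀ (sub_ne_zero.2 hσ)
    linear_combination h1 - h2
  have hb : algebraMap k K (p.coeff 0) = x * σ x := by
    rw [ha] at h1
    linear_combination h1
  refine ⟨ha, hb, fun τ => ?_⟩
  have h3 := hroot τ
  rw [ha, hb] at h3
  have : (τ x - x) * (τ x - σ x) = 0 := by linear_combination h3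
  rwa [mul_eq_zero, sub_eq_zero, sub_eq_zero] at this

namespace SetUp

variable {k : Type u} [Field k] {K : Type v} [Field K] [Algebra k K] (S : SetUp k K)

theorem quadratic_θ :
    algebraMap k K ((minpoly k S.θ).coeff 1) = -(S.θ + S.g S.θ) ∧
      algebraMap k K ((minpoly k S.θ).coeff 0) = S.θ * S.g S.θ ∧
      ∀ τ : K ≃ₐ[k] K, τ S.θ = S.θ ∨ τ S.θ = S.g S.θ :=
  minpoly_quadratic (S.adjoin_θ ▸ S.finrank_L) S.g_θ_ne

theorem quadratic_θ' :
    algebraMap k K ((minpoly k S.θ').coeff 1) = -(S.θ' + S.g S.θ') ∧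
      algebraMap k K ((minpoly k S.θ').coeff 0) = S.θ' * S.g S.θ' ∧
      ∀ τ : K ≃ₐ[k] K, τ S.θ' = S.θ' ∨ τ S.θ' = S.g S.θ' :=
  minpoly_quadratic (S.adjoin_θ' ▸ S.finrank_L') S.g_θ'_ne

theorem finiteDimensional (S : SetUp k K) : FiniteDimensional k K := by
  have : FiniteDimensional k S.L := Module.finite_of_finrank_eq_succ S.finrank_L
  have : FiniteDimensional k S.L' := Module.finite_of_finrank_eq_succ S.finrank_L'
  have : FiniteDimensional k (S.L ⊔ S.L' : IntermediateField k K) :=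
    IntermediateField.finiteDimensional_sup _ _
  rw [S.composite] at this
  exact Module.Finite.equiv (IntermediateField.topEquiv (F := k) (E := K)).toLinearEquiv

/-- Normality comes from the two quadratic extensions; separability is where perfectness of k
enters. -/
theorem isGalois [PerfectField k] (S : SetUp k K) : IsGalois k K := by
  have := S.finiteDimensional
  have : Algebra.IsQuadraticExtension k S.L := { finrank_eq_two' := S.finrank_L }
  have : Algebra.IsQuadraticExtension k S.L' := { finrank_eq_two' := S.finrank_L' }
  have : Normal k (S.L ⊔ S.L' : IntermediateField k K) := inferInstance
  rw [S.composite] at this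
  have : Normal k K := Normal.of_algEquiv (IntermediateField.topEquiv (F := k) (E := K))
  exact { }

theorem gal_ext {σ τ : K ≃ₐ[k] K} (h1 : σ S.θ = τ S.θ) (h2 : σ S.θ' = τ S.θ') : σ = τ := by
  have : τ⁻¹ * σ = 1 := by
    apply S.eq_one_of_fix
    · rw [AlgEquiv.mul_apply, h1, ← AlgEquiv.mul_apply, inv_mul_cancel, AlgEquiv.one_apply]
    · rw [AlgEquiv.mul_apply, h2, ← AlgEquiv.mul_apply, inv_mul_cancel, AlgEquiv.one_apply]
  exact (inv_mul_eq_one.1 this).symm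

theorem g_g_θ : S.g (S.g S.θ) = S.θ := by
  rcases S.quadratic_θ.2.2 (S.g * S.g) with h | h
  · exact h
  · exact absurd (S.g.injective h).symm S.g_θ_ne

theorem g_g_θ' : S.g (S.g S.θ') = S.θ' := by
  rcases S.quadratic_θ'.2.2 (S.g * S.g) with h | h
  · exact h
  · exact absurd (S.g.injective h).symm S.g_θ'_ne

theorem g_g (z : K) : S.g (S.g z) = z := by
  have : S.g * S.g = 1 := S.gal_ext S.g_g_θ S.g_g_θ'
  exact DFunLike.congr_fun this z

theorem h_θ (hL : S.L ≠ S.L') : S.h S.θ = S.g S.θ := by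
  obtain ⟨-, ⟨-, hh'⟩, hg⟩ := S.of_ne hL
  rw [hg, AlgEquiv.mul_apply, hh' _ S.θ_mem]

theorem h_θ' (hL : S.L ≠ S.L') : S.h S.θ' = S.θ' := (S.of_ne hL).1.2 _ S.θ'_mem

theorem h_g_θ (hL : S.L ≠ S.L') : S.h (S.g S.θ) = S.θ := by
  rcases S.quadratic_θ.2.2 (S.h * S.g) with h | h
  · exact h
  · rw [← S.h_θ hL, AlgEquiv.mul_apply] at h
    exact absurd (S.h.injective h).symm S.g_θ_ne

theorem h_g_θ' (hL : S.L ≠ S.L') : S.h (S.g S.θ') = S.g S.θ' := by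
  rcases S.quadratic_θ'.2.2 (S.h * S.g) with h | h
  · rw [AlgEquiv.mul_apply] at h
    nth_rw 2 [← S.h_θ' hL] at h
    exact absurd (S.h.injective h).symm S.g_θ'_ne
  · exact h

theorem h_g (hL : S.L ≠ S.L') (z : K) : S.h (S.g z) = S.g (S.h z) := by
  have : S.h * S.g = S.g * S.h := by
    apply S.gal_ext <;> simp only [AlgEquiv.mul_apply]
    · rw [S.h_g_θ hL, S.h_θ hL, S.g_g]
    · rw [S.h_g_θ' hL, S.h_θ' hL]
  exact DFunLike.congr_fun this z

/-- An automorphism is determined by its choice of conjugate for θ and for θ', and if L = L' the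
first choice determines the second. Galois invariance therefore needs checking only for g and, if L
≠ L', for h. -/
theorem gal_cases (σ : K ≃ₐ[k] K) :
    σ = 1 ∨ σ = S.g ∨ (S.L ≠ S.L' ∧ (σ = S.h ∨ σ = S.h * S.g)) := by
  by_cases hL : S.L = S.L'
  · have fix {τ ρ : K ≃ₐ[k] K} (h : τ S.θ = ρ S.θ) : τ = ρ := by
      have h1 : (ρ⁻¹ * τ) S.θ = S.θ := by
        rw [AlgEquiv.mul_apply, h, ← AlgEquiv.mul_apply, inv_mul_cancel, AlgEquiv.one_apply]
      have h2 : S.θ' ∈ k⟮S.θ⟯ := by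
        rw [S.adjoin_θ, hL]
        exact S.θ'_mem
      exact (inv_mul_eq_one.1 (S.eq_one_of_fix h1 (fix_adjoin h1 h2))).symm
    rcases S.quadratic_θ.2.2 σ with h | h
    · exact Or.inl (fix h)
    · exact Or.inr (Or.inl (fix h))
  · rcases S.quadratic_θ.2.2 σ with h | h <;> rcases S.quadratic_θ'.2.2 σ with h' | h'
    · exact Or.inl (S.gal_ext h h')
    · refine Or.inr (Or.inr ⟨hL, Or.inr (S.gal_ext ?_ ?_)⟩)
      · rw [h, AlgEquiv.mul_apply, S.h_g_θ hL]
      · rw [h', AlgEquiv.mul_apply, S.h_g_θ' hL]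
    · refine Or.inr (Or.inr ⟨hL, Or.inl (S.gal_ext ?_ ?_)⟩)
      · rw [h, S.h_θ hL]
      · rw [h', S.h_θ' hL]
    · exact Or.inr (Or.inl (S.gal_ext h h'))

theorem exists_algebraMap_eq [PerfectField k] {z : K} (hg : S.g z = z)
    (hh : S.L ≠ S.L' → S.h z = z) : ∃ a, algebraMap k K a = z := by
  have := S.finiteDimensional
  have := S.isGalois
  have : z ∈ (⊥ : IntermediateField k K) := by
    rw [IsGalois.mem_bot_iff_fixed]
    intro σ
    rcases S.gal_cases σ with rfl | rfl | ⟨hL, rfl | rfl⟩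
    · rfl
    · exact hg
    · exact hh hL
    · rw [AlgEquiv.mul_apply, hg, hh hL]
  exact this

/-! ### The coordinates of ε: relation to the fibration and Galois action -/

/-- The singular members of the pencil of conics other than `y z = 0` are the fibres over `-c₁`
and `-c₂`. -/
def c₁ : K := S.g S.θ * S.θ' + S.θ * S.g S.θ'

/-- See `c₁`. -/
def c₂ : K := S.θ * S.θ' + S.g S.θ * S.g S.θ'

theorem c₁_sub_c₂_ne : S.c₁ - S.c₂ ≠ 0 := by
  have : S.c₁ - S.c₂ = (S.θ' - S.g S.θ') * (S.g S.θ - S.θ) := by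
    simp only [c₁, c₂]; ring
  rw [this]
  exact mul_ne_zero (sub_ne_zero.2 S.g_θ'_ne) (sub_ne_zero.2 S.g_θ_ne.symm)

theorem g_c₁ : S.g S.c₁ = S.c₁ := by
  simp only [c₁, map_add, map_mul, S.g_g]; ring

theorem g_c₂ : S.g S.c₂ = S.c₂ := by
  simp only [c₂, map_add, map_mul, S.g_g]; ring

theorem h_c₁ (hL : S.L ≠ S.L') : S.h S.c₁ = S.c₂ := by
  simp only [c₁, c₂, map_add, map_mul, S.h_g_θ hL, S.h_g_θ' hL, S.h_θ hL, S.h_θ' hL]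

theorem h_c₂ (hL : S.L ≠ S.L') : S.h S.c₂ = S.c₁ := by
  simp only [c₁, c₂, map_add, map_mul, S.h_g_θ hL, S.h_g_θ' hL, S.h_θ hL, S.h_θ' hL]

/-- The rational function of the fibration, over `K`. -/
def fiberFn : FunField K := scalarExt k K S.fibration.fn

theorem fiberFn_mul : S.fiberFn * coord K 1 =
    (coord K 0 - algebraMap K _ S.θ' * coord K 1) *
      (coord K 0 - algebraMap K _ (S.g S.θ') * coord K 1)
      - algebraMap K _ (S.θ + S.g S.θ) * coord K 0 + algebraMap K _ (S.θ * S.g S.θ) := by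
  have hy := coord_ne_zero (k := K) 1
  simp only [fiberFn, fibration, conicFibration, dehomogenize, conicNum, conicDen, map_div₀,
    map_sub, map_add, map_mul, map_pow, MvPolynomial.aeval_X, MvPolynomial.aeval_C,
    scalarExt_const, S.quadratic_θ.1, S.quadratic_θ.2.1, S.quadratic_θ'.1, S.quadratic_θ'.2.1]
  simp [scalarExt_coord]
  field_simp
  ring

theorem fiberFn_pencil (a b : K) :
    algebraMap K _ a * S.fiberFn + algebraMap K _ b =
      algebraMap _ _ (pencil S.θ' (S.g S.θ') S.θ (S.g S.θ) a b) / coord K 1 := by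
  have hy := coord_ne_zero (k := K) 1
  rw [eq_div_iff hy, add_mul, mul_assoc, S.fiberFn_mul]
  simp only [pencil, map_sub, map_add, map_mul, algebraMap_C]
  simp [coord]

/-- The first coordinate of `ε`. -/
def fstε : FunField K := S.ε.pullback (coord K 0)

/-- The second coordinate of `ε`. -/
def sndε : FunField K := S.ε.pullback (coord K 1)

theorem sndε_eq : S.sndε =
    (coord K 0 - algebraMap K _ (S.g S.θ') * coord K 1 - algebraMap K _ (S.g S.θ)) /
      (-(coord K 0 - algebraMap K _ (S.g S.θ') * coord K 1) + algebraMap K _ S.θ) := by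
  simp only [sndε, ε, Bir.pullback_mul, gammaMap, betaMap, alphaMap, Bir.pullback_ofCoords]
  simp [Bir.pullback_ofCoords]

theorem fstε_eq : S.fstε =
    (coord K 0 - algebraMap K _ S.θ' * coord K 1 - algebraMap K _ S.θ) /
      (-(coord K 0 - algebraMap K _ S.θ' * coord K 1) + algebraMap K _ (S.g S.θ)) * S.sndε := by
  rw [sndε_eq]
  simp only [fstε, ε, Bir.pullback_mul, gammaMap, betaMap, alphaMap, Bir.pullback_ofCoords]
  simp [Bir.pullback_ofCoords]

/-- Both functions are pull-backs of coordinates under the birational map `alphaMap`, hence not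
constant. -/
theorem linear_ne (c : K) :
    coord K 0 - algebraMap K _ S.θ' * coord K 1 ≠ algebraMap K _ c ∧
    coord K 0 - algebraMap K _ (S.g S.θ') * coord K 1 ≠ algebraMap K _ c := by
  let f := alphaMap S.θ' (S.g S.θ') S.g_θ'_ne
  have h0 : f.pullback (coord K 0) = coord K 0 - algebraMap K _ S.θ' * coord K 1 :=
    Bir.pullback_ofCoords _ _ _
  have h1 : f.pullback (coord K 1) = coord K 0 - algebraMap K _ (S.g S.θ') * coord K 1 :=
    Bir.pullback_ofCoords _ _ _
  rw [← h0, ← h1, ← pullback_const f c]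
  exact ⟨fun h => coord_ne_const 0 c (f.pullback.injective h),
    fun h => coord_ne_const 1 c (f.pullback.injective h)⟩

theorem fstε_ne (c : K) : S.fstε ≠ algebraMap K _ c := fun h =>
  coord_ne_const 0 c (S.ε.pullback.injective (h.trans (pullback_const _ _).symm))

theorem fstε_ne_zero : S.fstε ≠ 0 := by simpa using S.fstε_ne 0

theorem sndε_ne_zero : S.sndε ≠ 0 := fun h =>
  coord_ne_zero (k := K) 1 (S.ε.pullback.injective (h.trans (map_zero _).symm))

/-- The two coordinates of β ∘ α are exchanged by g, so multiplying them by means of γ makes the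
first coordinate of ε the g-norm of the second. -/
theorem twist_g_sndε : twist (S.g : K ≃+* K) S.sndε = S.fstε / S.sndε := by
  rw [eq_div_iff S.sndε_ne_zero, fstε_eq]
  congr 1
  rw [sndε_eq]
  simp [S.g_g]

theorem fiberFn_add_c₂ : S.fiberFn + algebraMap K _ S.c₂ ≠ 0 := by
  have hy := coord_ne_zero (k := K) 1
  intro h0
  -- The fibre over -c₂ is a pair of lines.
  have h : (S.fiberFn + algebraMap K _ S.c₂) * coord K 1 =
      (coord K 0 - algebraMap K _ S.θ' * coord K 1 - algebraMap K _ (S.g S.θ)) *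
      (coord K 0 - algebraMap K _ (S.g S.θ') * coord K 1 - algebraMap K _ S.θ) := by
    rw [add_mul, fiberFn_mul]
    simp only [c₂, map_add, map_mul]
    ring
  rw [h0, zero_mul, eq_comm, mul_eq_zero, sub_eq_zero, sub_eq_zero] at h
  exact h.elim (S.linear_ne _).1 (S.linear_ne _).2

/-- Multiplied by y, each of t + c₁ and t + c₂ is a product of two linear factors, and these are the
factors in the numerator and the denominator of the first coordinate of ε. -/
theorem fstε_eq_fiberFn : S.fstε =
    (S.fiberFn + algebraMap K _ S.c₁) / (S.fiberFn + algebraMap K _ S.c₂) := by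
  have h1 : -(coord K 0 - algebraMap K _ S.θ' * coord K 1) + algebraMap K _ (S.g S.θ) ≠ 0 :=
    fun h => (S.linear_ne _).1 (neg_add_eq_zero.1 h)
  have h2 : -(coord K 0 - algebraMap K _ (S.g S.θ') * coord K 1) + algebraMap K _ S.θ ≠ 0 :=
    fun h => (S.linear_ne _).2 (neg_add_eq_zero.1 h)
  have hy := coord_ne_zero (k := K) 1
  rw [fstε_eq, sndε_eq, div_mul_div_comm, div_eq_div_iff (mul_ne_zero h1 h2) S.fiberFn_add_c₂]
  apply mul_right_cancel₀ hy
  have h := S.fiberFn_mul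
  simp only [c₁, c₂, map_add, map_mul] at h ⊢
  set ι := algebraMap K (FunField K)
  linear_combination (ι (S.g S.θ) * ι S.θ' + ι S.θ * ι (S.g S.θ') -
    (ι S.θ * ι S.θ' + ι (S.g S.θ) * ι (S.g S.θ'))) * coord K 1 * h

theorem twist_fiberFn (σ : K ≃ₐ[k] K) : twist (σ : K ≃+* K) S.fiberFn = S.fiberFn :=
  twist_scalarExt σ _

theorem twist_g_fstε : twist (S.g : K ≃+* K) S.fstε = S.fstε := by
  rw [fstε_eq_fiberFn, map_div₀, map_add, map_add, twist_fiberFn, twist_const, twist_const]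
  simp [S.g_c₁, S.g_c₂]

/-- The automorphism h exchanges the two singular fibres -c₁ and -c₂, that is, the zero and the
pole. -/
theorem twist_h_fstε (hL : S.L ≠ S.L') : twist (S.h : K ≃+* K) S.fstε = 1 / S.fstε := by
  rw [fstε_eq_fiberFn, map_div₀, map_add, map_add, twist_fiberFn, twist_const, twist_const]
  simp [S.h_c₁ hL, S.h_c₂ hL]

theorem twist_h_sndε (hL : S.L ≠ S.L') : twist (S.h : K ≃+* K) S.sndε = 1 / S.sndε := by
  rw [sndε_eq, one_div_div]
  simp [S.h_g_θ' hL, S.h_θ hL, S.h_g_θ hL]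
  rw [← neg_div_neg_eq]
  congr 1 <;> ring

end SetUp

/-! ### The generating involutions -/

section InvMap

variable {K : Type v} [Field K]

theorem invMap_coord_zero (m l : Kˣ) :
    (invMap m l).pullback (coord K 0) = 1 / (algebraMap K _ (m : K) * coord K 0) :=
  Bir.pullback_ofCoords _ _ 0

theorem invMap_coord_one (m l : Kˣ) :
    (invMap m l).pullback (coord K 1) = 1 / (algebraMap K _ (l : K) * coord K 1) :=
  Bir.pullback_ofCoords _ _ 1

theorem invMap_mul_self (m l : Kˣ) : invMap m l * invMap m l = 1 := by
  apply Bir.ext_coord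
  intro i
  have hc := coord_ne_zero (k := K) i
  rw [Bir.pullback_mul, Bir.pullback_one]
  fin_cases i
  · simp only [Fin.zero_eta, invMap_coord_zero, map_div₀, map_one, map_mul, pullback_const]
    have : algebraMap K (FunField K) (m : K) ≠ 0 := by simp
    field_simp
  · simp only [Fin.mk_one, invMap_coord_one, map_div₀, map_one, map_mul, pullback_const]
    have : algebraMap K (FunField K) (l : K) ≠ 0 := by simp
    field_simp

theorem invMap_ne_one (m l : Kˣ) : invMap m l ≠ 1 := by
  intro h
  have h1 := invMap_coord_one m l
  have hy := coord_ne_zero (k := K) 1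
  have hl : algebraMap K (FunField K) (l : K) ≠ 0 := by simp
  rw [h, Bir.pullback_one, eq_div_iff (mul_ne_zero hl hy)] at h1
  refine algebraicIndependent_coord.transcendental (R := K) (x := coord K) 1
    ⟨Polynomial.C (l : K) * Polynomial.X ^ 2 - 1, ?_, ?_⟩
  · intro h0
    have := congrArg (fun p => Polynomial.coeff p 2) h0
    simp [Polynomial.coeff_one] at this
  · simp only [map_sub, map_mul, Polynomial.aeval_C, Polynomial.aeval_X, map_pow, map_one]
    linear_combination h1

end InvMap

/-! ### The conjugated group is defined over k and preserves the fibration -/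

theorem conj_pullback {K : Type v} [Field K] (e s : Bir K) (z : FunField K) :
    (e⁻¹ * s * e).pullback (e.pullback z) = e.pullback (s.pullback z) := by
  rw [Bir.pullback_mul, Bir.pullback_mul, ← Bir.pullback_mul e e⁻¹, mul_inv_cancel,
    Bir.pullback_one]

theorem scalarExt_homography {k : Type u} [Field k] {K : Type v} [Field K] [Algebra k K]
    (M : GL (Fin 2) k) (z : FunField k) :
    scalarExt k K (homography M z) =
      (algebraMap K _ (algebraMap k K (M 0 0)) * scalarExt k K z +
        algebraMap K _ (algebraMap k K (M 0 1))) /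
      (algebraMap K _ (algebraMap k K (M 1 0)) * scalarExt k K z +
        algebraMap K _ (algebraMap k K (M 1 1))) := by
  simp only [homography, map_div₀, map_add, map_mul, scalarExt_const]

namespace SetUp

variable {k : Type u} [Field k] {K : Type v} [Field K] [Algebra k K] (S : SetUp k K)

theorem ringHom_ext_ε {E : Type*} [Field E] {f g : FunField K →+* E}
    (hc : ∀ a : K, f (algebraMap K _ a) = g (algebraMap K _ a))
    (h0 : f S.fstε = g S.fstε) (h1 : f S.sndε = g S.sndε) : f = g := by
  have : f.comp (S.ε.pullback : FunField K →+* FunField K) =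
      g.comp (S.ε.pullback : FunField K →+* FunField K) := by
    apply ringHom_ext_coord
    · intro a
      simpa [pullback_const] using hc a
    · intro i
      fin_cases i
      · exact h0
      · exact h1
  ext z
  obtain ⟨w, rfl⟩ := S.ε.pullback.surjective z
  exact DFunLike.congr_fun this w

/-- It suffices to compare both sides on the generators A and B for σ = g and σ = h. For g on B the
comparison amounts to μ = λλ^g, for h on B to λλ^h = 1; on A it needs the consequences μ^g = μ and
μμ^h = 1. -/
theorem twist_conj_invMap {l m : Kˣ} (hm : (m : K) = l * S.g l)
    (hl : S.L ≠ S.L' → (l : K) * S.h l = 1) (σ : K ≃ₐ[k] K) (z : FunField K) :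
    twist (σ : K ≃+* K) ((S.ε⁻¹ * invMap m l * S.ε).pullback z) =
      (S.ε⁻¹ * invMap m l * S.ε).pullback (twist (σ : K ≃+* K) z) := by
  have hA : (S.ε⁻¹ * invMap m l * S.ε).pullback S.fstε =
      1 / (algebraMap K _ (m : K) * S.fstε) := by
    rw [fstε, conj_pullback, invMap_coord_zero, map_div₀, map_mul, map_one, pullback_const]
  have hB : (S.ε⁻¹ * invMap m l * S.ε).pullback S.sndε =
      1 / (algebraMap K _ (l : K) * S.sndε) := by
    rw [sndε, conj_pullback, invMap_coord_one, map_div₀, map_mul, map_one, pullback_const]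
  set f := S.ε⁻¹ * invMap m l * S.ε with hf
  have hA0 := S.fstε_ne_zero
  have hB0 := S.sndε_ne_zero
  have hl0 : (l : K) ≠ 0 := l.ne_zero
  have hgl0 : S.g l ≠ 0 := by simp
  have hgm : S.g m = m := by rw [hm, map_mul, S.g_g, mul_comm]
  have red (σ : K ≃ₐ[k] K) (h0 : twist (σ : K ≃+* K) (f.pullback S.fstε) =
        f.pullback (twist (σ : K ≃+* K) S.fstε))
      (h1 : twist (σ : K ≃+* K) (f.pullback S.sndε) =
        f.pullback (twist (σ : K ≃+* K) S.sndε)) (z : FunField K) :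
      twist (σ : K ≃+* K) (f.pullback z) = f.pullback (twist (σ : K ≃+* K) z) := by
    have : (twist (σ : K ≃+* K)).comp (f.pullback : FunField K →+* FunField K) =
        (f.pullback : FunField K →+* FunField K).comp (twist (σ : K ≃+* K)) := by
      apply S.ringHom_ext_ε
      · intro a
        simp
      · exact h0
      · exact h1
    exact DFunLike.congr_fun this z
  have hg := red S.g
    (by
      rw [twist_g_fstε, hA, map_div₀, map_mul, map_one, twist_const_gal, twist_g_fstε]
      simp [hgm])
    (by
      have hi : algebraMap K (FunField K) (S.g l) ≠ 0 := by simp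
      have hi' : algebraMap K (FunField K) l ≠ 0 := by simp
      rw [twist_g_sndε, map_div₀, hA, hB, map_div₀, map_mul, map_one, twist_const_gal, twist_g_sndε,
        hm, map_mul]
      field_simp)
  have hh (hL : S.L ≠ S.L') := red S.h
    (by
      -- As g and h commute, μμ^h is the g-norm of λλ^h = 1.
      have hhm : (m : K) * S.h m = 1 := by
        have h1 := hl hL
        have h2 : S.g l * S.g (S.h l) = 1 := by rw [← map_mul, h1, map_one]
        rw [hm, map_mul, S.h_g hL]
        linear_combination S.g l * S.g (S.h l) * h1 + h2
      have hi : algebraMap K (FunField K) m * algebraMap K (FunField K) (S.h m) = 1 := by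
        rw [← map_mul, hhm, map_one]
      rw [twist_h_fstε _ hL, map_div₀, map_one, hA, map_div₀, map_mul, map_one, twist_const_gal,
        twist_h_fstε _ hL]
      rw [eq_inv_of_mul_eq_one_right hi]
      field_simp)
    (by
      have hi : algebraMap K (FunField K) l * algebraMap K (FunField K) (S.h l) = 1 := by
        rw [← map_mul, hl hL, map_one]
      rw [twist_h_sndε _ hL, map_div₀, map_one, hB, map_div₀, map_mul, map_one, twist_const_gal,
        twist_h_sndε _ hL]
      rw [eq_inv_of_mul_eq_one_right hi]
      field_simp)
  rcases S.gal_cases σ with rfl | rfl | ⟨hL, rfl | rfl⟩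
  · rw [twist_one, twist_one]
  · exact hg z
  · exact hh hL z
  · have e : ∀ w, twist ((S.h * S.g : K ≃ₐ[k] K) : K ≃+* K) w =
      twist (S.h : K ≃+* K) (twist (S.g : K ≃+* K) w) := fun w => (twist_twist _ _ w).symm
    rw [e, e, hg, hh hL]

theorem mem_jonquieres_of_fiberFn {f : Bir k} {p q r s : k} (hdet : p * s - q * r ≠ 0)
    (h : (baseChange k K f).pullback S.fiberFn =
      (algebraMap K _ (algebraMap k K p) * S.fiberFn + algebraMap K _ (algebraMap k K q)) /
      (algebraMap K _ (algebraMap k K r) * S.fiberFn + algebraMap K _ (algebraMap k K s))) :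
    f ∈ jonquieres S.fibration := by
  refine ⟨Matrix.GeneralLinearGroup.mkOfDetNeZero !![p, q; r, s]
    (by rwa [Matrix.det_fin_two_of]), (scalarExt k K).injective ?_⟩
  change scalarExt k K _ = scalarExt k K _
  rw [scalarExt_homography, ← Bir.pullback_extend]
  exact h

theorem fiberFn_ne (c : K) : S.fiberFn ≠ algebraMap K _ c := by
  intro h
  refine S.fstε_ne ((c + S.c₁) / (c + S.c₂)) ?_
  rw [fstε_eq_fiberFn, h]
  simp

/-- With T the image of t, the rule A ↦ 1/(μA) reads (T + c₁)/(T + c₂) = (t + c₂)/(μ(t + c₁)).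
Solving for T gives the matrix (c₂ - μc₁, c₂² - μc₁²; μ - 1, μc₁ - c₂), which must be rescaled to
have entries in k. -/
theorem conj_invMap_mem [PerfectField k] {l m : Kˣ} (hm : (m : K) = l * S.g l)
    (hl : S.L ≠ S.L' → (l : K) * S.h l = 1) :
    S.ε⁻¹ * invMap m l * S.ε ∈ (jonquieres S.fibration).map (baseChange k K) := by
  have := S.finiteDimensional
  have := S.isGalois
  obtain ⟨f, hf⟩ := exists_baseChange_eq (S.twist_conj_invMap hm hl)
  refine ⟨f, ?_, hf⟩
  have hgm : S.g m = m := by rw [hm, map_mul, S.g_g, mul_comm]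
  have hhm (hL : S.L ≠ S.L') : (m : K) * S.h m = 1 := by
    have h1 := hl hL
    have h2 : S.g l * S.g (S.h l) = 1 := by rw [← map_mul, h1, map_one]
    rw [hm, map_mul, S.h_g hL]
    linear_combination S.g l * S.g (S.h l) * h1 + h2
  have hA : (S.ε⁻¹ * invMap m l * S.ε).pullback S.fstε =
      1 / (algebraMap K _ (m : K) * S.fstε) := by
    rw [fstε, conj_pullback, invMap_coord_zero, map_div₀, map_mul, map_one, pullback_const]
  rw [← hf] at hA
  have hm0 : (m : K) ≠ 0 := m.ne_zero
  have hm1 : algebraMap K (FunField K) m ≠ 0 := by simp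
  have ht1 : S.fiberFn + algebraMap K _ S.c₁ ≠ 0 := fun h =>
    S.fiberFn_ne (-S.c₁) (by rw [map_neg]; exact eq_neg_of_add_eq_zero_left h)
  have ht2 := S.fiberFn_add_c₂
  set F := (baseChange k K f).pullback with hF
  have ht2' : F S.fiberFn + algebraMap K _ S.c₂ ≠ 0 := by
    have := F.injective.ne ht2
    rwa [map_add, map_zero, F.commutes] at this
  rw [fstε_eq_fiberFn, map_div₀, map_add, map_add, F.commutes, F.commutes, mul_div_assoc',
    one_div_div, div_eq_div_iff ht2' (mul_ne_zero hm1 ht1)] at hA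
  have hc := S.c₁_sub_c₂_ne
  -- For μ = 1 the lower left entry vanishes and the solution is T = -t - (c₁ + c₂); otherwise the
  -- matrix is divided by μ - 1.
  by_cases hm' : (m : K) = 1
  · obtain ⟨c, hc'⟩ := S.exists_algebraMap_eq (z := S.c₁ + S.c₂)
      (by rw [map_add, S.g_c₁, S.g_c₂])
      (fun hL => by rw [map_add, S.h_c₁ hL, S.h_c₂ hL, add_comm])
    refine S.mem_jonquieres_of_fiberFn (p := -1) (q := -c) (r := 0) (s := 1) (by simp) ?_
    have hc2 : algebraMap K (FunField K) S.c₁ - algebraMap K (FunField K) S.c₂ ≠ 0 := by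
      simpa only [map_sub] using (map_ne_zero (algebraMap K (FunField K))).2 hc
    rw [← hF]
    simp only [map_neg, map_one, map_zero, hc', map_add]
    rw [hm', map_one] at hA
    apply mul_left_cancel₀ hc2
    rw [zero_mul, zero_add, div_one]
    linear_combination hA
  · have hd : (m : K) - 1 ≠ 0 := sub_ne_zero.2 hm'
    obtain ⟨p, hp⟩ := S.exists_algebraMap_eq (z := (S.c₂ - m * S.c₁) / (m - 1))
      (by simp [S.g_c₁, S.g_c₂, hgm])
      (fun hL => by
        simp only [map_div₀, map_sub, map_mul, map_one, S.h_c₁ hL, S.h_c₂ hL]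
        rw [eq_inv_of_mul_eq_one_right (hhm hL)]
        have : (m : K)⁻¹ - 1 ≠ 0 := by
          rw [sub_ne_zero]; simpa using hm'
        rw [div_eq_div_iff this hd]
        field_simp
        ring)
    obtain ⟨q, hq⟩ := S.exists_algebraMap_eq (z := (S.c₂ ^ 2 - m * S.c₁ ^ 2) / (m - 1))
      (by simp [S.g_c₁, S.g_c₂, hgm])
      (fun hL => by
        simp only [map_div₀, map_sub, map_mul, map_one, map_pow, S.h_c₁ hL, S.h_c₂ hL]
        rw [eq_inv_of_mul_eq_one_right (hhm hL)]
        have : (m : K)⁻¹ - 1 ≠ 0 := by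
          rw [sub_ne_zero]; simpa using hm'
        rw [div_eq_div_iff this hd]
        field_simp
        ring)
    refine S.mem_jonquieres_of_fiberFn (p := p) (q := q) (r := 1) (s := -p) ?_ ?_
    -- The determinant is -μ(c₁ - c₂)²/(μ - 1)².
    · intro h0
      have := congrArg (algebraMap k K) h0
      simp only [map_sub, map_mul, map_neg, map_one, map_zero, hp, hq] at this
      field_simp at this
      refine mul_ne_zero hm0 (pow_ne_zero 2 hc) ?_
      linear_combination -this
    · rw [← hF, map_neg, map_neg, hp, hq, map_one, map_one]
      have h3 : 1 * S.fiberFn + -algebraMap K _ ((S.c₂ - m * S.c₁) / (m - 1)) ≠ 0 := by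
        intro h
        exact S.fiberFn_ne _ (by linear_combination h)
      rw [eq_div_iff h3]
      have hd' : algebraMap K (FunField K) (m : K) - 1 ≠ 0 := by
        simpa only [map_sub, map_one] using (map_ne_zero (algebraMap K (FunField K))).2 hd
      simp only [map_div₀, map_sub, map_mul, map_one, map_pow]
      field_simp
      linear_combination hA

theorem conjH_le [PerfectField k] :
    S.conjH ≤ (jonquieres S.fibration).map (baseChange k K) := by
  rw [conjH, Subgroup.map_le_iff_le_comap, H, Subgroup.closure_le]
  rintro _ ⟨l, m, hm, hl, rfl⟩
  rw [SetLike.mem_coe, Subgroup.mem_comap, MulEquiv.toMonoidHom_eq_coe, MonoidHom.coe_coe,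
    MulAut.conj_apply, inv_inv]
  exact S.conj_invMap_mem hm hl

/-! ### Surjectivity onto the automorphisms of the base -/

/-- If a homography of the fibre coordinate with invariant coefficients is a norm, then its zero
is one of the two points below the singular members of the pencil with conjugate components. -/
theorem eq_or_eq_of_eq_mul_twist {a b c d : K} (ha : S.g a = a) (hb : S.g b = b)
    (hdet : a * d - b * c ≠ 0) {z : FunField K}
    (hz : (algebraMap K _ a * S.fiberFn + algebraMap K _ b) /
      (algebraMap K _ c * S.fiberFn + algebraMap K _ d) = z * twist (S.g : K ≃+* K) z) :
    b = a * S.c₁ ∨ b = a * S.c₂ := by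
  by_contra! h
  have h0 : a ≠ 0 ∨ b ≠ 0 := by
    by_contra! h0
    simp [h0.1, h0.2] at hdet
  have hp : Prime (pencil S.θ' (S.g S.θ') S.θ (S.g S.θ) a b) :=
    prime_pencil S.g_θ'_ne h0 h.1 h.2
  rw [fiberFn_pencil, fiberFn_pencil, div_div_div_cancel_right₀ (coord_ne_zero 1)] at hz
  exact div_ne_mul_twist hp (map_pencil _ rfl S.g_g_θ' rfl S.g_g_θ ha hb)
    (not_pencil_dvd hp hdet) z hz

/-- A map over k commutes with the twist by g, so it preserves the norm relation A = B·B^g. -/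
theorem pullback_fstε_eq (f : Bir k) :
    (baseChange k K f).pullback S.fstε = (baseChange k K f).pullback S.sndε *
      twist (S.g : K ≃+* K) ((baseChange k K f).pullback S.sndε) := by
  rw [twist_pullback_baseChange, twist_g_sndε, ← map_mul, mul_div_cancel₀ _ S.sndε_ne_zero]

theorem pullback_fiberFn {f : Bir k} {M : GL (Fin 2) k}
    (hf : f.pullback S.fibration.fn = homography M S.fibration.fn) :
    (baseChange k K f).pullback S.fiberFn =
      (algebraMap K _ (algebraMap k K (M 0 0)) * S.fiberFn +
        algebraMap K _ (algebraMap k K (M 0 1))) /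
      (algebraMap K _ (algebraMap k K (M 1 0)) * S.fiberFn +
        algebraMap K _ (algebraMap k K (M 1 1))) := by
  have := congrArg (scalarExt k K) hf
  rw [scalarExt_homography, ← Bir.pullback_extend] at this
  exact this

theorem linear_fiberFn_ne_zero {a b : K} (h : a ≠ 0 ∨ b ≠ 0) :
    algebraMap K _ a * S.fiberFn + algebraMap K _ b ≠ 0 := by
  intro h0
  by_cases ha : a = 0
  · simp [ha] at h0 h
    exact h h0
  · refine S.fiberFn_ne (-b / a) ?_
    have : algebraMap K (FunField K) a ≠ 0 := by simpa using ha
    rw [map_div₀, map_neg, eq_div_iff this]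
    linear_combination h0

/-- As f^*A and its inverse are norms and homographies of t, the zero and the pole of f^*A both lie
in {-c₁, -c₂}. They are distinct, so f^*A has the divisor of A or of 1/A on the base. -/
theorem pullback_fstε_cases {f : Bir k} (hf : f ∈ jonquieres S.fibration) :
    ∃ n : K, n ≠ 0 ∧
      ((baseChange k K f).pullback S.fstε = algebraMap K _ n * S.fstε ∨
        (baseChange k K f).pullback S.fstε = algebraMap K _ n / S.fstε) := by
  obtain ⟨M, hM⟩ := hf
  have hT := S.pullback_fiberFn hM
  have hMdet : M 0 0 * M 1 1 - M 0 1 * M 1 0 ≠ 0 := by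
    have := M.det.ne_zero
    rwa [Matrix.GeneralLinearGroup.val_det_apply, Matrix.det_fin_two] at this
  have hdetK := (map_ne_zero (algebraMap k K)).2 hMdet
  have hnorm := S.pullback_fstε_eq f
  set F := (baseChange k K f).pullback with hF
  set p := algebraMap k K (M 0 0) with hp
  set q := algebraMap k K (M 0 1) with hq
  set r := algebraMap k K (M 1 0) with hr
  set s := algebraMap k K (M 1 1) with hs
  simp only [map_sub, map_mul, ← hp, ← hq, ← hr, ← hs] at hdetK
  have hrs : r ≠ 0 ∨ s ≠ 0 := by
    by_contra! h0
    simp [h0.1, h0.2] at hdetK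
  have hc := S.c₁_sub_c₂_ne
  -- These four constants are the coefficients of f^*A as a homography of t.
  obtain ⟨a, ha⟩ : ∃ a, a = p + S.c₁ * r := ⟨_, rfl⟩
  obtain ⟨b, hb⟩ : ∃ b, b = q + S.c₁ * s := ⟨_, rfl⟩
  obtain ⟨c, hc'⟩ : ∃ c, c = p + S.c₂ * r := ⟨_, rfl⟩
  obtain ⟨d, hd⟩ : ∃ d, d = q + S.c₂ * s := ⟨_, rfl⟩
  have hga : S.g a = a := by simp [ha, hp, hr, S.g_c₁]
  have hgb : S.g b = b := by simp [hb, hq, hs, S.g_c₁]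
  have hgc : S.g c = c := by simp [hc', hp, hr, S.g_c₂]
  have hgd : S.g d = d := by simp [hd, hq, hs, S.g_c₂]
  have hdet : a * d - b * c ≠ 0 := by
    have : a * d - b * c = -(S.c₁ - S.c₂) * (p * s - q * r) := by rw [ha, hb, hc', hd]; ring
    rw [this]
    exact mul_ne_zero (neg_ne_zero.2 hc) hdetK
  have hdet' : c * b - d * a ≠ 0 := by
    intro h
    exact hdet (by linear_combination -h)
  have hFA : F S.fstε = (algebraMap K _ a * S.fiberFn + algebraMap K _ b) /
      (algebraMap K _ c * S.fiberFn + algebraMap K _ d) := by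
    have h1 := S.linear_fiberFn_ne_zero hrs
    rw [fstε_eq_fiberFn, map_div₀, map_add, map_add, F.commutes, F.commutes, hT,
      div_add' _ _ _ h1, div_add' _ _ _ h1, div_div_div_cancel_right₀ h1, ha, hb, hc', hd]
    simp only [map_add, map_mul]
    congr 1 <;> ring
  have hnum := S.eq_or_eq_of_eq_mul_twist hga hgb hdet (hFA.symm.trans hnorm)
  have hden : d = c * S.c₁ ∨ d = c * S.c₂ := by
    -- The pole is the zero of the inverse, which is the norm of the inverse of f^*B.
    refine S.eq_or_eq_of_eq_mul_twist hgc hgd hdet' (z := (F S.sndε)⁻¹) ?_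
    rw [map_inv₀, ← mul_inv, ← hnorm, hFA, inv_div]
  have ha0 : a ≠ 0 := by
    rintro rfl
    rcases hnum with h | h <;> simp [h] at hdet
  have hc0 : c ≠ 0 := by
    rintro rfl
    rcases hden with h | h <;> simp [h] at hdet
  refine ⟨a / c, div_ne_zero ha0 hc0, ?_⟩
  have hιc : algebraMap K (FunField K) c ≠ 0 := by simpa using hc0
  rcases hnum with h | h <;> rcases hden with h' | h'
  · exact absurd (by rw [h, h']; ring) hdet
  · left
    rw [hFA, fstε_eq_fiberFn, h, h', map_div₀, map_mul, map_mul, ← mul_add, ← mul_add,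
      mul_div_mul_comm]
  · right
    rw [hFA, fstε_eq_fiberFn, h, h', map_div₀, map_mul, map_mul, ← mul_add, ← mul_add,
      mul_div_mul_comm, div_div_eq_mul_div, mul_div_assoc]
  · exact absurd (by rw [h, h']; ring) hdet

theorem twist_h_pullback_sndε {f : Bir k} (hL : S.L ≠ S.L') :
    (baseChange k K f).pullback S.sndε *
      twist (S.h : K ≃+* K) ((baseChange k K f).pullback S.sndε) = 1 := by
  rw [twist_pullback_baseChange, twist_h_sndε _ hL, ← map_mul, mul_one_div_cancel S.sndε_ne_zero,
    map_one]

theorem mul_twist_h_sndε (hL : S.L ≠ S.L') : S.sndε * twist (S.h : K ≃+* K) S.sndε = 1 := by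
  rw [twist_h_sndε _ hL, mul_one_div_cancel S.sndε_ne_zero]

theorem mul_twist_g_sndε : S.sndε * twist (S.g : K ≃+* K) S.sndε = S.fstε := by
  rw [twist_g_sndε, mul_div_cancel₀ _ S.sndε_ne_zero]

/-- Solvability of the norm equations by a function implies solvability by a constant, namely its
leading coefficient; one constant serves for g and h at once. -/
theorem exists_unit {z : FunField K} (hz : z ≠ 0) {n : K} (hn : n ≠ 0)
    (hg : z * twist (S.g : K ≃+* K) z = algebraMap K _ n)
    (hh : S.L ≠ S.L' → z * twist (S.h : K ≃+* K) z = 1) :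
    ∃ l m : Kˣ, (m : K) = n ∧ (m : K) = l * S.g l ∧ (S.L ≠ S.L' → (l : K) * S.h l = 1) := by
  obtain ⟨l, hl, H⟩ := exists_const_of_mul_twist_eq hz
  refine ⟨Units.mk0 l hl, Units.mk0 n hn, rfl, (H S.g n hg).symm, fun hL => ?_⟩
  exact H S.h 1 (by rw [hh hL, map_one])

theorem exists_mem_H {f : Bir k} (hf : f ∈ jonquieres S.fibration) :
    ∃ s ∈ S.H, (S.ε⁻¹ * s * S.ε).pullback S.fstε = (baseChange k K f).pullback S.fstε := by
  obtain ⟨n, hn, h⟩ := S.pullback_fstε_cases hf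
  have hB0 := S.sndε_ne_zero
  have hA0 := S.fstε_ne_zero
  have hFB0 : (baseChange k K f).pullback S.sndε ≠ 0 := by simpa using hB0
  have hg := S.pullback_fstε_eq f
  have hinv {l m : Kˣ} (hm : (m : K) = l * S.g l) (hl : S.L ≠ S.L' → (l : K) * S.h l = 1) :
      invMap m l ∈ S.H := Subgroup.subset_closure ⟨l, m, hm, hl, rfl⟩
  rcases h with h | h
  · obtain ⟨l, m, hmn, hm, hl⟩ := S.exists_unit (div_ne_zero hFB0 hB0) hn
      (by rw [map_div₀, div_mul_div_comm, ← hg, mul_twist_g_sndε, h, mul_div_cancel_right₀ _ hA0])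
      (fun hL => by
        rw [map_div₀, div_mul_div_comm, S.twist_h_pullback_sndε hL, S.mul_twist_h_sndε hL, div_one])
    -- A single generator inverts A up to a constant, so A ↦ nA takes two: the one with λ = 1 undoes
    -- the inversion.
    refine ⟨invMap 1 1 * invMap m l, mul_mem (hinv (by simp) (by simp)) (hinv hm hl), ?_⟩
    rw [fstε, conj_pullback, ← fstε, h, Bir.pullback_mul, invMap_coord_zero]
    simp only [map_div₀, map_mul, map_one, pullback_const, invMap_coord_zero, Units.val_one, hmn]
    rw [one_mul, one_div_one_div]
    rfl
  · obtain ⟨l, m, hmn, hm, hl⟩ := S.exists_unit (mul_ne_zero hFB0 hB0) hn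
      (by rw [map_mul, mul_mul_mul_comm, ← hg, mul_twist_g_sndε, h, div_mul_cancel₀ _ hA0])
      (fun hL => by
        rw [map_mul, mul_mul_mul_comm, S.twist_h_pullback_sndε hL, S.mul_twist_h_sndε hL, one_mul])
    -- Inverses are needed because a generator with parameter μ sends A to 1/(μA), and n/A is
    -- wanted.
    refine ⟨invMap m⁻¹ l⁻¹, hinv (by simp [hm, mul_comm])
      (fun hL => by rw [Units.val_inv_eq_inv_val, map_inv₀, ← mul_inv, hl hL, inv_one]), ?_⟩
    rw [fstε, conj_pullback, ← fstε, h, invMap_coord_zero]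
    simp only [map_div₀, map_mul, map_one, pullback_const, Units.val_inv_eq_inv_val, map_inv₀, hmn]
    rw [one_div, mul_inv, inv_inv, div_eq_mul_inv]
    rfl

/-- Inverting the homography gives t = (c₂A - c₁)/(1 - A), so the action on A determines the action
on t. -/
theorem pullback_fiberFn_eq {f₁ f₂ : Bir K} (h : f₁.pullback S.fstε = f₂.pullback S.fstε) :
    f₁.pullback S.fiberFn = f₂.pullback S.fiberFn := by
  have hA : 1 - S.fstε ≠ 0 := by
    rw [sub_ne_zero]
    simpa using (S.fstε_ne 1).symm
  have key : S.fiberFn =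
      (algebraMap K _ S.c₂ * S.fstε - algebraMap K _ S.c₁) / (1 - S.fstε) := by
    rw [eq_div_iff hA]
    have := S.fstε_eq_fiberFn
    rw [eq_div_iff S.fiberFn_add_c₂] at this
    linear_combination -this
  rw [key]
  simp only [map_div₀, map_sub, map_mul, map_one, pullback_const, h]

theorem mem_conjH {s : Bir K} (hs : s ∈ S.H) : S.ε⁻¹ * s * S.ε ∈ S.conjH := by
  refine Subgroup.mem_map.2 ⟨s, hs, ?_⟩
  rw [MulEquiv.toMonoidHom_eq_coe, MonoidHom.coe_coe, MulAut.conj_apply, inv_inv]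

/-- Given f, the element of H that agrees with it on A descends, after conjugation by ε, to a map
over k agreeing with f on t; both therefore induce the same automorphism of the base. -/
theorem map_baseAction_conjH [PerfectField k] :
    ((S.conjH.comap (baseChange k K)).subgroupOf (jonquieres S.fibration)).map
      (baseAction S.fibration) = autBase S.fibration := by
  apply le_antisymm
  · exact Subgroup.map_le_range _ _
  · rintro _ ⟨f, rfl⟩
    obtain ⟨s, hs, h⟩ := S.exists_mem_H f.2
    have hmem := S.mem_conjH hs
    obtain ⟨f₁, hf₁, h₁⟩ := Subgroup.mem_map.1 (S.conjH_le hmem)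
    rw [← h₁] at h hmem
    refine Subgroup.mem_map.2 ⟨⟨f₁, hf₁⟩, ?_, ?_⟩
    · rw [Subgroup.mem_subgroupOf, Subgroup.mem_comap]
      exact hmem
    · obtain ⟨M, hM⟩ := f.2
      rw [(baseAction_eq_mk_iff S.fibration f M).2 hM, baseAction_eq_mk_iff, ← hM]
      apply (scalarExt k K).injective
      have := S.pullback_fiberFn_eq h
      change scalarExt k K _ = scalarExt k K _
      rw [← Bir.pullback_extend K f₁, ← Bir.pullback_extend K (f : Bir k)]
      exact this

end SetUp

end Jonq22

end

theorem proposition3p22 {k : Type*} [Field k] [PerfectField k] {K : Type*} [Field K] [Algebra k K]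
    (S : Jonq22.SetUp k K) :
    (∀ s ∈ S.involutions, s * s = 1 ∧ s ≠ 1) ∧
    S.conjH ≤ (Jonq22.jonquieres S.fibration).map (Jonq22.baseChange k K) ∧
    ((S.conjH.comap (Jonq22.baseChange k K)).subgroupOf (Jonq22.jonquieres S.fibration)).map
        (Jonq22.baseAction S.fibration) = Jonq22.autBase S.fibration := by
  refine ⟨?_, S.conjH_le, S.map_baseAction_conjH⟩
  rintro _ ⟨l, m, -, -, rfl⟩
  exact ⟨Jonq22.invMap_mul_self m l, Jonq22.invMap_ne_one m l⟩
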